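/- **Theorem.** Let $q:\mathbb R\to\mathbb R$ be integrable with compact (essential) support. For $k\in\mathbb C$ let $\psi_\pm(\cdot,k)$ be the solutions of $$-f''+q(x)f=k^2f\quad\text{on }\mathbb R$$ ($f'$ locally absolutely continuous, the equation holding almost everywhere) with $\psi_+(x,k)=e^{ixk}$ for all large positive $x$ and $\psi_-(x,k)=e^{-ixk}$ for all large negative $x$. These solutions exist and are unique, the Wronskian $$w(k)=\psi_-(x,k)\psi_+'(x,k)-\psi_-'(x,k)\psi_+(x,k)$$ does not depend on $x$ (here $'=d/dx$), and $w$, $\psi_+(0,\cdot)$ and $\psi_+'(0,\cdot)$ are entire functions of $k$. For an entire function $F$ let $\mathcal N(r,F)$ be the number of zeros of $F$ in $\{|k|\le r\}$, counted with multiplicity. Put $$\|q\|=\int_{\mathbb R}|q(t)|\,dt,\qquad \|q\|_1=\int_{\mathbb R}|t\,q(t)|\,dt,\qquad Q=\max\{\|q\|,\|q\|_1\}.$$ Let $r>0$ and $r_1=r+\tfrac12$. 1. (The line.) If $\operatorname{supp}q\subset[0,\gamma]$, $\gamma\ge0$, but $\operatorname{supp} q$ is contained in no smaller nonempty closed interval,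 then $$\mathcal N(r,w)\le\frac1{\log2}\left(\frac{4r_1\gamma}{\pi}+\log(1+4r_1)+\frac{9Q}{1+4r_1}\right).$$ 2. (The half-line.) If $\operatorname{supp}q\subset[0,\infty)$ (that is, $q$ is a potential on the half-line, extended by $0$) and $\gamma=\sup(\operatorname{supp}q)$, with $\gamma=0$ if $q=0$ almost everywhere, then $$\frac{\mathcal N(r,\psi_+(0,\cdot))+\mathcal N(r,\psi_+'(0,\cdot))}2\le\frac1{\log2}\left(\frac{4r_1\gamma}{\pi}+\log(1+4r_1)+\frac{9\|q\|\max\{1,\gamma\}}{1+4r_1}\right).$$ -/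

import Mathlib

open MeasureTheory Set Filter Topology
open scoped ENNReal

/-- The (essential) support of a potential `q`: the points all of whose neighbourhoods meet
`{q ≠ 0}` in a set of positive Lebesgue measure. It depends only on the a.e.-class of `q`. -/
noncomputable def essSupport (q : ℝ → ℝ) : Set ℝ :=
  (volume.restrict (Function.support q)).support

/-- The support of `q` is contained in the nonempty interval `[a, b]`, but in no smaller nonempty
closed interval. (For `q = 0` the interval is then a single point.) -/
def IsSupportInterval (q : ℝ → ℝ) (a b : ℝ) : Prop :=
  a ≤ b ∧ essSupport q ⊆ Icc a b ∧
    ∀ c d : ℝ, c ≤ d → essSupport q ⊆ Icc c d → Icc c d ⊆ Icc a b → Icc c d = Icc a b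

/-- `f` solves `-f'' + q f = k² f` on the line: `f` is differentiable, `f'` is locally absolutely
continuous, and the equation holds almost everywhere. -/
structure IsSchrodingerSolution (q : ℝ → ℝ) (k : ℂ) (f : ℝ → ℂ) : Prop where
  differentiable : Differentiable ℝ f
  absolutelyContinuous : ∀ a b : ℝ, AbsolutelyContinuousOnInterval (deriv f) a b
  equation : ∀ᵐ x : ℝ, -deriv (deriv f) x + (q x : ℂ) * f x = k ^ 2 * f x

/-- `f` is the Jost solution `ψ₊(·, k)`: a solution equal to `e^{ixk}` for large positive `x`. -/
def IsJostPlus (q : ℝ → ℝ) (k : ℂ) (f : ℝ → ℂ) : Prop :=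
  IsSchrodingerSolution q k f ∧ ∀ᶠ x : ℝ in atTop, f x = Complex.exp (Complex.I * x * k)

/-- `f` is the Jost solution `ψ₋(·, k)`: a solution equal to `e^{-ixk}` for large negative `x`. -/
def IsJostMinus (q : ℝ → ℝ) (k : ℂ) (f : ℝ → ℂ) : Prop :=
  IsSchrodingerSolution q k f ∧ ∀ᶠ x : ℝ in atBot, f x = Complex.exp (-(Complex.I * x * k))

/-- `ψ₊(x, k)`. -/
noncomputable def jostPlus (q : ℝ → ℝ) (x : ℝ) (k : ℂ) : ℂ :=
  Classical.epsilon (IsJostPlus q k) x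

/-- `ψ₋(x, k)`. -/
noncomputable def jostMinus (q : ℝ → ℝ) (x : ℝ) (k : ℂ) : ℂ :=
  Classical.epsilon (IsJostMinus q k) x

/-- `ψ₊'(x, k)`, the derivative in `x`. -/
noncomputable def jostPlusDeriv (q : ℝ → ℝ) (x : ℝ) (k : ℂ) : ℂ :=
  deriv (fun t : ℝ => jostPlus q t k) x

/-- `ψ₋'(x, k)`, the derivative in `x`. -/
noncomputable def jostMinusDeriv (q : ℝ → ℝ) (x : ℝ) (k : ℂ) : ℂ :=
  deriv (fun t : ℝ => jostMinus q t k) x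

/-- The Wronskian `{ψ₋(·, k), ψ₊(·, k)} = ψ₋ ψ₊' - ψ₋' ψ₊` at the point `x`. -/
noncomputable def jostWronskianAt (q : ℝ → ℝ) (x : ℝ) (k : ℂ) : ℂ :=
  jostMinus q x k * jostPlusDeriv q x k - jostMinusDeriv q x k * jostPlus q x k

/-- The Wronskian `w(k)`; it does not depend on the point at which it is evaluated. -/
noncomputable def jostWronskian (q : ℝ → ℝ) (k : ℂ) : ℂ :=
  jostWronskianAt q 0 k

/-- The number of zeros `z` of the entire function `f` with `|z| ≤ r`, counted with multiplicity
(a value in `[0, ∞]`, infinite for `f = 0` and `r > 0`). -/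
noncomputable def zeroCount (r : ℝ) (f : ℂ → ℂ) : ℝ≥0∞ :=
  ∑' z : Metric.closedBall (0 : ℂ) r, ((analyticOrderAt f (z : ℂ) : ℕ∞) : ℝ≥0∞)

/-- `‖q‖ = ∫ |q(t)| dt`. -/
noncomputable def potentialNorm (q : ℝ → ℝ) : ℝ := ∫ t : ℝ, |q t|

/-- `‖q‖₁ = ∫ |t q(t)| dt`. -/
noncomputable def potentialMoment (q : ℝ → ℝ) : ℝ := ∫ t : ℝ, |t * q t|

theorem LipschitzOnWith.comp_absolutelyContinuousOnInterval {X Y : Type*} [PseudoMetricSpace X]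
    [PseudoMetricSpace Y] {g : X → Y} {K : NNReal} {s : Set X} (hg : LipschitzOnWith K g s)
    {f : ℝ → X} {a b : ℝ} (hf : AbsolutelyContinuousOnInterval f a b)
    (hs : ∀ x ∈ uIcc a b, f x ∈ s) :
    AbsolutelyContinuousOnInterval (fun x => g (f x)) a b := by
  unfold AbsolutelyContinuousOnInterval at hf ⊢
  refine squeeze_zero' ?_ ?_ (by simpa using hf.const_mul (K : ℝ))
  · exact Eventually.of_forall fun _ => Finset.sum_nonneg fun i hi => dist_nonneg
  rw [eventually_inf_principal]
  filter_upwards with (n, I) hnI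
  rw [Finset.mul_sum]
  refine Finset.sum_le_sum fun i hi => ?_
  exact hg.dist_le_mul _ (hs _ (hnI.left i hi).left) _ (hs _ (hnI.left i hi).right)

/-- The indefinite integral of a locally integrable complex function is absolutely continuous. -/
theorem MeasureTheory.LocallyIntegrable.absolutelyContinuousOnInterval_integral {m : ℝ → ℂ}
    (hm : LocallyIntegrable m volume) (c a b : ℝ) :
    AbsolutelyContinuousOnInterval (fun x => ∫ t in c..x, m t) a b := by
  have hi : ∀ x y, IntervalIntegrable m volume x y := fun x y =>
    (hm.integrableOn_isCompact isCompact_uIcc).intervalIntegrable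
  have key : ∀ φ : ℝ → ℝ, (∀ x y, IntervalIntegrable φ volume x y) →
      AbsolutelyContinuousOnInterval (fun x => ∫ t in c..x, φ t) a b := by
    intro φ hφ
    obtain ⟨u, v, hu, hc⟩ : ∃ u v, uIcc a b ⊆ uIcc u v ∧ c ∈ uIcc u v := by
      refine ⟨min c (min a b), max c (max a b), ?_, ?_⟩
      · rw [uIcc_of_le (a := min c (min a b)) (by simp), uIcc]
        exact Icc_subset_Icc (by simp) (by simp)
      · rw [uIcc_of_le (by simp)]
        simp
    exact ((hφ u v).absolutelyContinuousOnInterval_intervalIntegral hc).mono hu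
  have hof : LipschitzOnWith 1 (fun x : ℝ => (x : ℂ)) univ :=
    (Complex.isometry_ofReal.lipschitz).lipschitzOnWith
  have h1 := hof.comp_absolutelyContinuousOnInterval
    (key (fun t => (m t).re) (fun x y => ⟨(hi x y).1.re, (hi x y).2.re⟩)) (fun _ _ => mem_univ _)
  have h2 := hof.comp_absolutelyContinuousOnInterval
    (key (fun t => (m t).im) (fun x y => ⟨(hi x y).1.im, (hi x y).2.im⟩)) (fun _ _ => mem_univ _)
  have h3 := h1.fun_add (h2.const_smul Complex.I)
  have h4 : (fun x => ∫ t in c..x, m t) = fun x =>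
      (((∫ t in c..x, (m t).re : ℝ) : ℂ) + Complex.I • ((∫ t in c..x, (m t).im : ℝ) : ℂ)) := by
    ext x
    have e1 := Complex.reCLM.intervalIntegral_comp_comm (hi c x)
    have e2 := Complex.imCLM.intervalIntegral_comp_comm (hi c x)
    simp only [Complex.reCLM_apply, Complex.imCLM_apply] at e1 e2
    rw [e1, e2, smul_eq_mul, mul_comm Complex.I, Complex.re_add_im]
  rwa [h4]

theorem AbsolutelyContinuousOnInterval.ae_differentiableAt_complex {f : ℝ → ℂ}
    (hf : ∀ a b, AbsolutelyContinuousOnInterval f a b) : ∀ᵐ x, DifferentiableAt ℝ f x := by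
  have h : ∀ n : ℕ, ∀ᵐ x, x ∈ uIcc (-(n : ℝ)) n → DifferentiableAt ℝ f x := fun n =>
    (hf (-n) n).boundedVariationOn.ae_differentiableAt_of_mem_uIcc
  filter_upwards [ae_all_iff.2 h] with x hx
  obtain ⟨n, hn⟩ := exists_nat_ge |x|
  refine hx n ?_
  rw [uIcc_of_le (by linarith [abs_nonneg x])]
  exact ⟨by linarith [neg_abs_le x], by linarith [le_abs_self x]⟩

theorem eq_of_ae_hasDerivAt_zero {E : Type*} [NormedAddCommGroup E] [NormedSpace ℝ E] {f : ℝ → E}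
    {x y : ℝ}
    (hf : AbsolutelyContinuousOnInterval f x y) (h : ∀ᵐ t, t ∈ uIcc x y → HasDerivAt f 0 t) :
    f x = f y := by
  obtain ⟨C, hC⟩ := hf.const_of_ae_hasDerivAt_zero h
  rw [hC x left_mem_uIcc, hC y right_mem_uIcc]

/-- The fundamental theorem of calculus for locally absolutely continuous functions. -/
theorem integral_eq_sub_of_ae_hasDerivAt {f g : ℝ → ℂ}
    (hf : ∀ a b, AbsolutelyContinuousOnInterval f a b) (hg : LocallyIntegrable g volume)
    (h : ∀ᵐ t, HasDerivAt f (g t) t) (x y : ℝ) : ∫ t in x..y, g t = f y - f x := by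
  have := eq_of_ae_hasDerivAt_zero (x := x) (y := y)
    ((hf x y).fun_sub (hg.absolutelyContinuousOnInterval_integral x x y)) (by
      filter_upwards [h, _root_.LocallyIntegrable.ae_hasDerivAt_integral hg] with t h1 h2 _
      have h3 := h1.sub (h2 x)
      rw [sub_self] at h3
      exact h3)
  simp only [intervalIntegral.integral_same, sub_zero] at this
  rw [this]; ring

theorem integral_mul_exp_primitive {m : ℝ → ℝ} {x b l : ℝ} (hm : IntervalIntegrable m volume x b)
    (hl : l ≠ 0) :
    ∫ t in x..b, m t * Real.exp (l * ∫ s in t..b, m s) =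
      (Real.exp (l * ∫ s in x..b, m s) - 1) / l := by
  have hA : AbsolutelyContinuousOnInterval (fun t => l * ∫ s in t..b, m s) x b := by
    have := (hm.absolutelyContinuousOnInterval_intervalIntegral
      (c := b) right_mem_uIcc).const_mul (-l)
    convert this using 2 with t
    rw [intervalIntegral.integral_symm]; ring
  obtain ⟨M, hM⟩ := hA.exists_bound
  have hLip : ∃ K, LipschitzOnWith K Real.exp (Icc (-M) M) :=
    Real.contDiff_exp.contDiffOn.exists_lipschitzOnWith (n := 1) (by decide) (convex_Icc _ _)
      isCompact_Icc
  obtain ⟨K, hK⟩ := hLip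
  have hE := hK.comp_absolutelyContinuousOnInterval hA fun t ht => abs_le.1 (hM t ht)
  have hd : ∀ᵐ t, t ∈ uIcc x b → HasDerivAt (fun t => Real.exp (l * ∫ s in t..b, m s))
      (-l * (m t * Real.exp (l * ∫ s in t..b, m s))) t := by
    filter_upwards [hm.ae_hasDerivAt_integral] with t ht htm
    have h1 := ((ht htm b right_mem_uIcc).neg.const_mul l).exp
    simp_rw [Pi.neg_apply, ← intervalIntegral.integral_symm] at h1
    convert h1 using 1
    ring
  have h2 := hE.integral_deriv_eq_sub
  have h3 : ∫ t in x..b, deriv (fun t => Real.exp (l * ∫ s in t..b, m s)) t =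
      ∫ t in x..b, -l * (m t * Real.exp (l * ∫ s in t..b, m s)) := by
    refine intervalIntegral.integral_congr_ae ?_
    filter_upwards [hd] with t ht htm
    exact (ht (uIoc_subset_uIcc htm)).deriv
  rw [h3, intervalIntegral.integral_const_mul] at h2
  simp only [intervalIntegral.integral_same, mul_zero, Real.exp_zero] at h2
  field_simp
  linarith

/-- Grönwall's inequality for a Volterra integral inequality with integrable kernel. -/
theorem le_mul_exp_of_le_add_integral {m y : ℝ → ℝ} {a b c : ℝ}
    (hm : IntervalIntegrable m volume a b) (hm0 : ∀ t, 0 ≤ m t) (hy : ContinuousOn y (Icc a b))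
    (h : ∀ x ∈ Icc a b, y x ≤ c + ∫ t in x..b, m t * y t) :
    ∀ x ∈ Icc a b, y x ≤ c * Real.exp (∫ t in x..b, m t) := by
  intro x₀ hx₀
  have hab : a ≤ b := hx₀.1.trans hx₀.2
  have hmx : ∀ x ∈ Icc a b, IntervalIntegrable m volume x b := fun x hx =>
    hm.mono_set (by rw [uIcc_of_le hab, uIcc_of_le hx.2]; exact Icc_subset_Icc_left hx.1)
  have hAc : ContinuousOn (fun x => ∫ t in x..b, m t) (Icc a b) := by
    have := (hm.absolutelyContinuousOnInterval_intervalIntegral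
      (c := b) right_mem_uIcc).continuousOn.neg
    rw [uIcc_of_le hab] at this
    refine this.congr fun t ht => ?_
    rw [intervalIntegral.integral_symm]; rfl
  have hAe : ∀ l : ℝ, ContinuousOn (fun x => Real.exp (l * ∫ t in x..b, m t)) (Icc a b) :=
    fun l => (hAc.const_smul l).rexp
  set D : ℝ → ℝ := fun x => y x - c * Real.exp (1 * ∫ t in x..b, m t) with hD
  have hDc : ContinuousOn D (Icc a b) := hy.sub ((hAe 1).const_smul c)
  have hDle : ∀ x ∈ Icc a b, D x ≤ ∫ t in x..b, m t * D t := by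
    intro x hx
    have hsub : uIcc x b ⊆ Icc a b := by
      rw [uIcc_of_le hx.2]; exact Icc_subset_Icc_left hx.1
    have e1 : ∫ t in x..b, m t * D t = (∫ t in x..b, m t * y t) -
        c * ∫ t in x..b, m t * Real.exp (1 * ∫ s in t..b, m s) := by
      rw [← intervalIntegral.integral_const_mul, ← intervalIntegral.integral_sub]
      · congr 1; ext t; simp only [hD]; ring
      · exact (hmx x hx).mul_continuousOn (hy.mono hsub)
      · exact ((hmx x hx).mul_continuousOn ((hAe 1).mono hsub)).const_mul c
    rw [e1, integral_mul_exp_primitive (hmx x hx) one_ne_zero]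
    have := h x hx
    simp only [hD]
    linarith
  obtain ⟨z, hz, hzmax⟩ := isCompact_Icc.exists_isMaxOn (⟨x₀, hx₀⟩ : (Icc a b).Nonempty)
    (hDc.mul (hAe (-2)))
  set S := D z * Real.exp (-2 * ∫ t in z..b, m t) with hS
  have hDS : ∀ t ∈ Icc a b, D t ≤ S * Real.exp (2 * ∫ s in t..b, m s) := by
    intro t ht
    have h1 : D t * Real.exp (-2 * ∫ s in t..b, m s) ≤ S := hzmax ht
    have h2 := mul_le_mul_of_nonneg_right h1 (Real.exp_pos (2 * ∫ s in t..b, m s)).le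
    rwa [mul_assoc, ← Real.exp_add, neg_mul, neg_add_cancel, Real.exp_zero, mul_one] at h2
  have hSle : S ≤ 0 := by
    by_contra! hpos
    have hsub : uIcc z b ⊆ Icc a b := by
      rw [uIcc_of_le hz.2]; exact Icc_subset_Icc_left hz.1
    have h1 : D z ≤ ∫ t in z..b, S * (m t * Real.exp (2 * ∫ s in t..b, m s)) := by
      refine (hDle z hz).trans (intervalIntegral.integral_mono_on hz.2
        ((hmx z hz).mul_continuousOn (hDc.mono hsub))
        (((hmx z hz).mul_continuousOn ((hAe 2).mono hsub)).const_mul S) fun t ht => ?_)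
      have := mul_le_mul_of_nonneg_left (hDS t ⟨hz.1.trans ht.1, ht.2⟩) (hm0 t)
      linarith
    rw [intervalIntegral.integral_const_mul, integral_mul_exp_primitive (hmx z hz) two_ne_zero] at h1
    have hDz : D z = S * Real.exp (2 * ∫ s in z..b, m s) := by
      rw [hS, mul_assoc, ← Real.exp_add, neg_mul, neg_add_cancel, Real.exp_zero, mul_one]
    rw [hDz] at h1
    nlinarith [Real.exp_pos (2 * ∫ s in z..b, m s)]
  have h1 := hDS x₀ hx₀
  have h2 : S * Real.exp (2 * ∫ s in x₀..b, m s) ≤ 0 :=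
    mul_nonpos_of_nonpos_of_nonneg hSle (Real.exp_pos _).le
  simp only [hD, one_mul] at h1
  linarith

/-- The entire function `k ↦ sin (k t) / k`. -/
noncomputable def sinDiv (k : ℂ) (t : ℝ) : ℂ := dslope (fun z : ℂ => Complex.sin (z * t)) 0 k

theorem hasDerivAt_sin_mul_const (t : ℝ) (k : ℂ) :
    HasDerivAt (fun z : ℂ => Complex.sin (z * t)) (Complex.cos (k * t) * t) k := by
  simpa using ((hasDerivAt_id k).mul_const (t : ℂ)).csin

theorem sinDiv_zero (t : ℝ) : sinDiv 0 t = t := by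
  simp [sinDiv, (hasDerivAt_sin_mul_const t 0).deriv]

theorem sinDiv_of_ne {k : ℂ} (hk : k ≠ 0) (t : ℝ) : sinDiv k t = Complex.sin (k * t) / k := by
  simp [sinDiv, dslope_of_ne _ hk, slope_def_field]

@[simp]
theorem sinDiv_apply_zero (k : ℂ) : sinDiv k 0 = 0 := by
  rcases eq_or_ne k 0 with rfl | hk
  · simp [sinDiv_zero]
  · simp [sinDiv_of_ne hk]

theorem mul_sinDiv (k : ℂ) (t : ℝ) : k * sinDiv k t = Complex.sin (k * t) := by
  rcases eq_or_ne k 0 with rfl | hk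
  · simp
  · rw [sinDiv_of_ne hk]; field_simp

theorem hasDerivAt_cos_mul (k : ℂ) (t : ℝ) :
    HasDerivAt (fun s : ℝ => Complex.cos (k * s)) (-(k ^ 2 * sinDiv k t)) t := by
  have h := (((hasDerivAt_id (t : ℂ)).const_mul k).ccos).comp_ofReal
  simp only [id, mul_one] at h
  convert h using 1
  rw [pow_two, mul_assoc, mul_sinDiv]; ring

theorem hasDerivAt_sinDiv (k : ℂ) (t : ℝ) :
    HasDerivAt (fun s : ℝ => sinDiv k s) (Complex.cos (k * t)) t := by
  rcases eq_or_ne k 0 with rfl | hk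
  · simpa [sinDiv_zero] using (hasDerivAt_id t).ofReal_comp
  · have h := ((((hasDerivAt_id (t : ℂ)).const_mul k).csin).div_const k).comp_ofReal
    simp only [id, mul_one, mul_div_cancel_right₀ _ hk] at h
    simpa only [sinDiv_of_ne hk] using h

@[fun_prop]
theorem continuous_sinDiv (k : ℂ) : Continuous (fun t : ℝ => sinDiv k t) :=
  continuous_iff_continuousAt.2 fun t => (hasDerivAt_sinDiv k t).continuousAt

theorem cos_sq_add_sinDiv_sq (k : ℂ) (t : ℝ) :
    Complex.cos (k * t) ^ 2 + k ^ 2 * sinDiv k t ^ 2 = 1 := by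
  rw [← mul_pow, mul_sinDiv, Complex.cos_sq_add_sin_sq]

theorem isUnit_one_sub_of_norm_pow_lt_one {R : Type*} [NormedRing R] [HasSummableGeomSeries R]
    {x : R} {n : ℕ} (h : ‖x ^ n‖ < 1) : IsUnit (1 - x) := by
  have hu := isUnit_one_sub_of_norm_lt_one h
  rw [← mul_neg_geom_sum] at hu
  refine ((Commute.isUnit_mul_iff ?_).1 hu).1
  exact (mul_neg_geom_sum x n).trans (geom_sum_mul_neg x n).symm

/-- The operator `u ↦ C W (S u) - S W (C u)` on a Banach algebra. -/
noncomputable def crossOperator {A : Type*} [NormedCommRing A] [NormedAlgebra ℂ A]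
    (W : A →L[ℂ] A) (C S : A) : A →L[ℂ] A :=
  ContinuousLinearMap.mul ℂ A C ∘SL W ∘SL ContinuousLinearMap.mul ℂ A S -
    ContinuousLinearMap.mul ℂ A S ∘SL W ∘SL ContinuousLinearMap.mul ℂ A C

theorem differentiable_inverse_one_sub_crossOperator {A : Type*} [NormedCommRing A]
    [NormedAlgebra ℂ A] [CompleteSpace A] {W : A →L[ℂ] A} {C S e : ℂ → A}
    (hC : Differentiable ℂ C) (hS : Differentiable ℂ S) (he : Differentiable ℂ e)
    (hu : ∀ k, IsUnit (1 - crossOperator W (C k) (S k))) :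
    Differentiable ℂ fun k => Ring.inverse (1 - crossOperator W (C k) (S k)) (e k) := by
  intro k
  have hmul : ∀ f : ℂ → A, Differentiable ℂ f →
      DifferentiableAt ℂ (fun k => ContinuousLinearMap.mul ℂ A (f k)) k := fun f hf =>
    (ContinuousLinearMap.mul ℂ A).differentiableAt.comp k (hf k)
  have hT : DifferentiableAt ℂ (fun k => 1 - crossOperator W (C k) (S k)) k :=
    (differentiableAt_const _).sub
      (((hmul _ hC).clm_comp ((differentiableAt_const _).clm_comp (hmul _ hS))).sub
        ((hmul _ hS).clm_comp ((differentiableAt_const _).clm_comp (hmul _ hC))))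
  exact ((differentiableAt_inverse (hu k)).comp k hT).clm_apply (he k)

section ContinuousMaps

variable {a b : ℝ}

/-- The function `t ↦ e^{kt}` on a compact interval. -/
noncomputable def expMap (a b : ℝ) (k : ℂ) : C(Icc a b, ℂ) :=
  ⟨fun t => Complex.exp (k * (t : ℝ)), by fun_prop⟩

theorem differentiable_expMap : Differentiable ℂ (expMap a b) := by
  let X : C(Icc a b, ℂ) := ⟨fun t => ((t : ℝ) : ℂ), by fun_prop⟩
  have h : expMap a b = fun k => NormedSpace.exp (k • X) := by
    ext k t
    let _ : NormedAlgebra ℚ C(Icc a b, ℂ) := NormedAlgebra.restrictScalars ℚ ℂ _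
    have := NormedSpace.map_exp (ContinuousMap.evalAlgHom ℂ ℂ t) (ContinuousMap.evalCLM ℂ t).continuous
      (k • X)
    simp only [ContinuousMap.evalAlgHom_apply] at this
    rw [this, ← Complex.exp_eq_exp_ℂ]
    rfl
  rw [h]
  exact fun k => (hasDerivAt_exp_smul_const X k).differentiableAt

/-- The function `t ↦ cos (kt)` on a compact interval. -/
noncomputable def cosMap (a b : ℝ) (k : ℂ) : C(Icc a b, ℂ) :=
  ⟨fun t => Complex.cos (k * (t : ℝ)), by fun_prop⟩

/-- The function `t ↦ sin (kt)` on a compact interval. -/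
noncomputable def sinMap (a b : ℝ) (k : ℂ) : C(Icc a b, ℂ) :=
  ⟨fun t => Complex.sin (k * (t : ℝ)), by fun_prop⟩

/-- The function `t ↦ sin (kt) / k` on a compact interval. -/
noncomputable def sinDivMap (a b : ℝ) (k : ℂ) : C(Icc a b, ℂ) :=
  ⟨fun t => sinDiv k t, by fun_prop⟩

theorem differentiable_expMap_mul (c : ℂ) : Differentiable ℂ fun k => expMap a b (c * k) :=
  differentiable_expMap.comp (differentiable_id.const_mul c)

theorem differentiable_cosMap : Differentiable ℂ (cosMap a b) := by
  have h : cosMap a b = fun k => (2⁻¹ : ℂ) •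
      (expMap a b (Complex.I * k) + expMap a b (-Complex.I * k)) := by
    ext k t
    simp only [cosMap, expMap, ContinuousMap.coe_mk, ContinuousMap.smul_apply,
      ContinuousMap.add_apply, Complex.cos, smul_eq_mul]
    ring_nf
  rw [h]
  exact ((differentiable_expMap_mul (a := a) (b := b) Complex.I).add
    (differentiable_expMap_mul (a := a) (b := b) (-Complex.I))).const_smul (2⁻¹ : ℂ)

theorem differentiable_sinMap : Differentiable ℂ (sinMap a b) := by
  have h : sinMap a b = fun k => (Complex.I / 2 : ℂ) •
      (expMap a b (-Complex.I * k) - expMap a b (Complex.I * k)) := by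
    ext k t
    simp only [sinMap, expMap, ContinuousMap.coe_mk, ContinuousMap.smul_apply,
      ContinuousMap.sub_apply, Complex.sin, smul_eq_mul]
    ring_nf
  rw [h]
  exact ((differentiable_expMap_mul (a := a) (b := b) (-Complex.I)).sub
    (differentiable_expMap_mul (a := a) (b := b) Complex.I)).const_smul (Complex.I / 2 : ℂ)

theorem differentiable_sinDivMap : Differentiable ℂ (sinDivMap a b) := by
  have h : sinDivMap a b = dslope (sinMap a b) 0 := by
    ext k t
    exact ContinuousLinearMap.dslope_comp (ContinuousMap.evalCLM ℂ t) (sinMap a b) 0 k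
      fun _ => differentiable_sinMap 0
  rw [h, ← differentiableOn_univ, Complex.differentiableOn_dslope univ_mem]
  exact differentiable_sinMap.differentiableOn

variable {q : ℝ → ℝ}

theorem intervalIntegrable_ofReal_mul (hq : Integrable q volume) {u : ℝ → ℂ} (hu : Continuous u)
    (x y : ℝ) : IntervalIntegrable (fun t => (q t : ℂ) * u t) volume x y :=
  (hq.ofReal.intervalIntegrable).mul_continuousOn hu.continuousOn

theorem continuous_integral_left {E : Type*} [NormedAddCommGroup E] [NormedSpace ℝ E] {f : ℝ → E}
    (hf : ∀ x y, IntervalIntegrable f volume x y) (c : ℝ) :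
    Continuous fun x => ∫ t in x..c, f t := by
  have h : (fun x => ∫ t in x..c, f t) = fun x => -∫ t in c..x, f t := by
    ext x; exact intervalIntegral.integral_symm c x
  rw [h]
  exact (intervalIntegral.continuous_primitive hf c).neg

/-- The operator `u ↦ ∫_x^b q u` on continuous functions on `[a, b]`. -/
noncomputable def tailIntegral (h : a ≤ b) (hq : Integrable q volume) :
    C(Icc a b, ℂ) →L[ℂ] C(Icc a b, ℂ) :=
  LinearMap.mkContinuous
    { toFun := fun u => ⟨fun x => ∫ t in (x : ℝ)..b, (q t : ℂ) * u (projIcc a b h t), by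
        exact (continuous_integral_left (intervalIntegrable_ofReal_mul hq
          (by fun_prop)) b).comp continuous_subtype_val⟩
      map_add' := fun u v => by
        ext x
        simp only [ContinuousMap.coe_mk, ContinuousMap.add_apply, mul_add]
        exact intervalIntegral.integral_add (intervalIntegrable_ofReal_mul hq (by fun_prop) _ _)
          (intervalIntegrable_ofReal_mul hq (by fun_prop) _ _)
      map_smul' := fun c u => by
        ext x
        simp only [ContinuousMap.coe_mk, ContinuousMap.smul_apply, smul_eq_mul, RingHom.id_apply]
        rw [← intervalIntegral.integral_const_mul]
        congr 1; ext t; ring }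
    (∫ t, |q t|) fun u => by
      rw [ContinuousMap.norm_le _ (by positivity)]
      intro x
      refine (intervalIntegral.norm_integral_le_integral_norm x.2.2).trans ?_
      calc ∫ t in (x : ℝ)..b, ‖(q t : ℂ) * u (projIcc a b h t)‖
          ≤ ∫ t in (x : ℝ)..b, |q t| * ‖u‖ := by
            refine intervalIntegral.integral_mono_on x.2.2
              (intervalIntegrable_ofReal_mul hq (by fun_prop) _ _).norm
              (hq.abs.intervalIntegrable.mul_const _) fun t _ => ?_
            rw [norm_mul, Complex.norm_real, Real.norm_eq_abs]
            gcongr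
            exact u.norm_coe_le_norm _
        _ = (∫ t in (x : ℝ)..b, |q t|) * ‖u‖ := intervalIntegral.integral_mul_const _ _
        _ ≤ _ := by
            gcongr
            rw [intervalIntegral.integral_of_le x.2.2]
            exact setIntegral_le_integral hq.abs (Eventually.of_forall fun t => abs_nonneg _)

theorem tailIntegral_apply (h : a ≤ b) (hq : Integrable q volume) (u : C(Icc a b, ℂ))
    (x : Icc a b) :
    tailIntegral h hq u x = ∫ t in (x : ℝ)..b, (q t : ℂ) * u (projIcc a b h t) := rfl

theorem norm_tailIntegral_le (h : a ≤ b) (hq : Integrable q volume) {u : C(Icc a b, ℂ)} {K l : ℝ}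
    (hK : 0 ≤ K) (hl : 0 < l)
    (hu : ∀ x : Icc a b, ‖u x‖ ≤ K * Real.exp (l * ∫ t in (x : ℝ)..b, |q t|)) (x : Icc a b) :
    ‖tailIntegral h hq u x‖ ≤ K / l * Real.exp (l * ∫ t in (x : ℝ)..b, |q t|) := by
  rw [tailIntegral_apply]
  refine (intervalIntegral.norm_integral_le_integral_norm x.2.2).trans ?_
  have hi : IntervalIntegrable (fun t => |q t|) volume x b := hq.abs.intervalIntegrable
  have hc : Continuous fun t => Real.exp (l * ∫ s in t..b, |q s|) :=
    ((continuous_integral_left (fun _ _ => hq.abs.intervalIntegrable) b).const_smul l).rexp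
  calc ∫ t in (x : ℝ)..b, ‖(q t : ℂ) * u (projIcc a b h t)‖
      ≤ ∫ t in (x : ℝ)..b, K * (|q t| * Real.exp (l * ∫ s in t..b, |q s|)) := by
        refine intervalIntegral.integral_mono_on x.2.2
          (intervalIntegrable_ofReal_mul hq (by fun_prop) _ _).norm
          ((hi.mul_continuousOn hc.continuousOn).const_mul _) fun t ht => ?_
        rw [norm_mul, Complex.norm_real, Real.norm_eq_abs]
        have ht' : t ∈ Icc a b := ⟨x.2.1.trans ht.1, ht.2⟩
        have := mul_le_mul_of_nonneg_left (hu (projIcc a b h t)) (abs_nonneg (q t))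
        rw [projIcc_of_mem h ht'] at this ⊢
        simp only at this
        linarith
    _ = K * ((Real.exp (l * ∫ s in (x : ℝ)..b, |q s|) - 1) / l) := by
        rw [intervalIntegral.integral_const_mul, integral_mul_exp_primitive hi hl.ne']
    _ ≤ _ := by
        rw [mul_div_assoc', div_mul_eq_mul_div]
        gcongr
        linarith

/-- The Volterra operator `u ↦ ∫_x^b (C(x) S(t) - S(x) C(t)) q(t) u(t) dt`. -/
noncomputable def volterra (h : a ≤ b) (hq : Integrable q volume) (C S : C(Icc a b, ℂ)) :
    C(Icc a b, ℂ) →L[ℂ] C(Icc a b, ℂ) :=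
  crossOperator (tailIntegral h hq) C S

theorem volterra_apply (h : a ≤ b) (hq : Integrable q volume) (C S u : C(Icc a b, ℂ)) :
    volterra h hq C S u = C * tailIntegral h hq (S * u) - S * tailIntegral h hq (C * u) := rfl

theorem norm_volterra_pow_le (h : a ≤ b) (hq : Integrable q volume) {C S : C(Icc a b, ℂ)} {M : ℝ}
    (hM : 0 < M) (hC : ‖C‖ ≤ M) (hS : ‖S‖ ≤ M) (n : ℕ) (u : C(Icc a b, ℂ)) (x : Icc a b) :
    ‖(volterra h hq C S ^ n) u x‖ ≤
      ‖u‖ * (1 / 2) ^ n * Real.exp (4 * M ^ 2 * ∫ t in (x : ℝ)..b, |q t|) := by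
  induction n generalizing x with
  | zero =>
    have h1 : 1 ≤ Real.exp (4 * M ^ 2 * ∫ t in (x : ℝ)..b, |q t|) := by
      refine Real.one_le_exp (mul_nonneg (by positivity) ?_)
      exact intervalIntegral.integral_nonneg x.2.2 fun t _ => abs_nonneg _
    simpa using (u.norm_coe_le_norm x).trans (le_mul_of_one_le_right (norm_nonneg u) h1)
  | succ n ih =>
    rw [pow_succ', mul_apply_eq_comp]
    set v := (volterra h hq C S ^ n) u
    have key : ∀ D : C(Icc a b, ℂ), ‖D‖ ≤ M → ‖tailIntegral h hq (D * v) x‖ ≤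
        M * (‖u‖ * (1 / 2) ^ n) / (4 * M ^ 2) *
          Real.exp (4 * M ^ 2 * ∫ t in (x : ℝ)..b, |q t|) := by
      intro D hD
      refine norm_tailIntegral_le h hq (by positivity) (by positivity) (fun y => ?_) x
      rw [ContinuousMap.mul_apply, norm_mul, mul_assoc]
      exact mul_le_mul ((D.norm_coe_le_norm y).trans hD) (ih y) (norm_nonneg _) hM.le
    rw [volterra_apply, ContinuousMap.sub_apply, ContinuousMap.mul_apply, ContinuousMap.mul_apply]
    refine (norm_sub_le _ _).trans ?_
    rw [norm_mul, norm_mul]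
    have h1 := mul_le_mul ((C.norm_coe_le_norm x).trans hC) (key S hS) (norm_nonneg _) hM.le
    have h2 := mul_le_mul ((S.norm_coe_le_norm x).trans hS) (key C hC) (norm_nonneg _) hM.le
    refine (add_le_add h1 h2).trans (le_of_eq ?_)
    field_simp
    ring

theorem isUnit_one_sub_volterra (h : a ≤ b) (hq : Integrable q volume) (C S : C(Icc a b, ℂ)) :
    IsUnit (1 - volterra h hq C S) := by
  set T := volterra h hq C S with hT
  set M := ‖C‖ + ‖S‖ + 1 with hM
  set E := Real.exp (4 * M ^ 2 * ∫ t in a..b, |q t|) with hE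
  have hbound : ∀ n : ℕ, ‖T ^ n‖ ≤ (1 / 2) ^ n * E := by
    intro n
    refine ContinuousLinearMap.opNorm_le_bound _ (by positivity) fun u => ?_
    rw [ContinuousMap.norm_le _ (by positivity)]
    intro x
    refine (norm_volterra_pow_le h hq (M := M) (by positivity)
      (by linarith [norm_nonneg S]) (by linarith [norm_nonneg C]) n u x).trans ?_
    have : Real.exp (4 * M ^ 2 * ∫ t in (x : ℝ)..b, |q t|) ≤ E := by
      refine Real.exp_le_exp.2 (mul_le_mul_of_nonneg_left ?_ (by positivity))
      exact intervalIntegral.integral_mono_interval x.2.1 x.2.2 le_rfl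
        (Eventually.of_forall fun t => abs_nonneg _) hq.abs.intervalIntegrable
    calc _ ≤ ‖u‖ * (1 / 2) ^ n * E := by gcongr
      _ = _ := by ring
  have hlim : Tendsto (fun n : ℕ => (1 / 2 : ℝ) ^ n * E) atTop (𝓝 (0 * E)) :=
    (tendsto_pow_atTop_nhds_zero_of_lt_one (by norm_num) (by norm_num)).mul_const E
  rw [zero_mul] at hlim
  obtain ⟨n, hn⟩ := (hlim.eventually_lt_const one_pos).exists
  exact isUnit_one_sub_of_norm_pow_lt_one (x := T) ((hbound n).trans_lt hn)

/-- The Jost solution `ψ₊(·, k)` on `[a, b]` when `q` vanishes beyond `b`. -/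
noncomputable def jostMap (h : a ≤ b) (hq : Integrable q volume) (k : ℂ) : C(Icc a b, ℂ) :=
  Ring.inverse (1 - volterra h hq (cosMap a b k) (sinDivMap a b k)) (expMap a b (Complex.I * k))

theorem jostMap_eq (h : a ≤ b) (hq : Integrable q volume) (k : ℂ) :
    jostMap h hq k = expMap a b (Complex.I * k) +
      volterra h hq (cosMap a b k) (sinDivMap a b k) (jostMap h hq k) := by
  set T := volterra h hq (cosMap a b k) (sinDivMap a b k) with hT
  have h1 := Ring.mul_inverse_cancel (1 - T) (isUnit_one_sub_volterra h hq _ _)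
  have h2 := congrArg (fun L => L (expMap a b (Complex.I * k))) h1
  simp only [mul_apply_eq_comp, one_apply_eq_self,
    _root_.sub_apply] at h2
  rw [sub_eq_iff_eq_add] at h2
  exact h2

theorem differentiable_jostMap (h : a ≤ b) (hq : Integrable q volume) :
    Differentiable ℂ (jostMap h hq) := 
  differentiable_inverse_one_sub_crossOperator differentiable_cosMap differentiable_sinDivMap
    (differentiable_expMap_mul Complex.I) fun _ => isUnit_one_sub_volterra h hq _ _

end ContinuousMaps

theorem absolutelyContinuousOnInterval_of_hasDerivAt {f f' : ℝ → ℂ} (h : ∀ t, HasDerivAt f (f' t) t)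
    (hf' : Continuous f') (a b : ℝ) : AbsolutelyContinuousOnInterval f a b := by
  refine ContDiffOn.absolutelyContinuousOnInterval (ContDiff.contDiffOn ?_)
  rw [contDiff_one_iff_deriv]
  refine ⟨fun t => (h t).differentiableAt, ?_⟩
  rwa [show deriv f = f' from funext fun t => (h t).deriv]

theorem AbsolutelyContinuousOnInterval.mul_complex {f g : ℝ → ℂ} {a b : ℝ}
    (hf : AbsolutelyContinuousOnInterval f a b) (hg : AbsolutelyContinuousOnInterval g a b) :
    AbsolutelyContinuousOnInterval (fun t => f t * g t) a b :=
  hf.smul hg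

theorem continuous_of_absolutelyContinuousOnInterval {f : ℝ → ℂ}
    (hf : ∀ a b, AbsolutelyContinuousOnInterval f a b) : Continuous f := by
  refine continuous_iff_continuousAt.2 fun x => ?_
  refine (hf (x - 1) (x + 1)).continuousOn.continuousAt ?_
  rw [uIcc_of_le (by linarith)]
  exact Icc_mem_nhds (by linarith) (by linarith)

/-- A locally absolutely continuous function with a continuous a.e. derivative is differentiable. -/
theorem hasDerivAt_of_ae_hasDerivAt {f g : ℝ → ℂ}
    (hf : ∀ a b, AbsolutelyContinuousOnInterval f a b) (hg : Continuous g)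
    (h : ∀ᵐ t, HasDerivAt f (g t) t) (x : ℝ) : HasDerivAt f (g x) x := by
  have e : f = fun y => f 0 + ∫ t in (0 : ℝ)..y, g t := by
    ext y
    rw [integral_eq_sub_of_ae_hasDerivAt hf hg.locallyIntegrable h]
    ring
  rw [e]
  exact (intervalIntegral.integral_hasDerivAt_right (hg.intervalIntegrable _ _)
    hg.stronglyMeasurable.stronglyMeasurableAtFilter hg.continuousAt).const_add _

theorem absolutelyContinuousOnInterval_cos_mul (k : ℂ) (x y : ℝ) :
    AbsolutelyContinuousOnInterval (fun t : ℝ => Complex.cos (k * t)) x y :=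
  absolutelyContinuousOnInterval_of_hasDerivAt (hasDerivAt_cos_mul k) (by fun_prop) x y

theorem absolutelyContinuousOnInterval_sinDiv (k : ℂ) (x y : ℝ) :
    AbsolutelyContinuousOnInterval (fun t : ℝ => sinDiv k t) x y :=
  absolutelyContinuousOnInterval_of_hasDerivAt (hasDerivAt_sinDiv k) (by fun_prop) x y

theorem exp_eq_cos_add_sinDiv (k : ℂ) (x : ℝ) :
    Complex.exp (Complex.I * x * k) = Complex.cos (k * x) + Complex.I * k * sinDiv k x := by
  rw [mul_assoc Complex.I k, mul_sinDiv, mul_comm Complex.I (Complex.sin _), ← Complex.exp_mul_I]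
  ring_nf

section Existence

variable {q : ℝ → ℝ} {a b : ℝ}

/-- The coefficient of `cos (kx)` in the Jost solution. -/
noncomputable def jostCos (h : a ≤ b) (hq : Integrable q volume) (k : ℂ) (x : ℝ) : ℂ :=
  1 + ∫ t in x..b, (q t : ℂ) * (sinDiv k t * jostMap h hq k (projIcc a b h t))

/-- The coefficient of `sin (kx) / k` in the Jost solution. -/
noncomputable def jostSin (h : a ≤ b) (hq : Integrable q volume) (k : ℂ) (x : ℝ) : ℂ :=
  Complex.I * k - ∫ t in x..b, (q t : ℂ) * (Complex.cos (k * t) * jostMap h hq k (projIcc a b h t))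

/-- The Jost solution obtained by variation of constants. -/
noncomputable def jostSol (h : a ≤ b) (hq : Integrable q volume) (k : ℂ) (x : ℝ) : ℂ :=
  jostCos h hq k x * Complex.cos (k * x) + jostSin h hq k x * sinDiv k x

/-- The derivative of `jostSol`. -/
noncomputable def jostSolDeriv (h : a ≤ b) (hq : Integrable q volume) (k : ℂ) (x : ℝ) : ℂ :=
  jostCos h hq k x * -(k ^ 2 * sinDiv k x) + jostSin h hq k x * Complex.cos (k * x)

variable (h : a ≤ b) (hq : Integrable q volume) (k : ℂ)

theorem jostSol_eq_jostMap {x : ℝ} (hx : x ∈ Icc a b) :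
    jostSol h hq k x = jostMap h hq k (projIcc a b h x) := by
  have e : ∀ (D : C(Icc a b, ℂ)) (D' : ℝ → ℂ), (∀ t : Icc a b, D t = D' t) →
      tailIntegral h hq (D * jostMap h hq k) ⟨x, hx⟩ =
        ∫ t in x..b, (q t : ℂ) * (D' t * jostMap h hq k (projIcc a b h t)) := by
    intro D D' hD
    rw [tailIntegral_apply]
    refine intervalIntegral.integral_congr fun t ht => ?_
    simp only at ht ⊢
    rw [uIcc_of_le hx.2] at ht
    rw [ContinuousMap.mul_apply, hD, projIcc_of_mem h ⟨hx.1.trans ht.1, ht.2⟩]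
  have h1 := congrArg (fun u : C(Icc a b, ℂ) => u ⟨x, hx⟩) (jostMap_eq h hq k)
  simp only [volterra_apply, ContinuousMap.add_apply, ContinuousMap.sub_apply,
    ContinuousMap.mul_apply] at h1
  rw [e _ (fun t => sinDiv k t) fun t => rfl, e _ (fun t => Complex.cos (k * t)) fun t => rfl] at h1
  rw [projIcc_of_mem h hx, h1, jostSol, jostCos, jostSin]
  simp only [expMap, cosMap, sinDivMap, ContinuousMap.coe_mk]
  have h2 := exp_eq_cos_add_sinDiv k x
  rw [show Complex.I * k * (x : ℂ) = Complex.I * x * k by ring, h2]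
  ring

theorem integrable_mul_jostMap {u : ℝ → ℂ} (hu : Continuous u) :
    LocallyIntegrable (fun t => (q t : ℂ) * (u t * jostMap h hq k (projIcc a b h t))) volume :=
  hq.ofReal.locallyIntegrable.mul_continuous (by fun_prop)

theorem jostCos_eq_primitive : jostCos h hq k = fun t => 1 - ∫ v in b..t, (q v : ℂ) *
      (sinDiv k v * jostMap h hq k (projIcc a b h v)) := by
  funext t
  rw [jostCos, intervalIntegral.integral_symm b t]
  ring

theorem absolutelyContinuousOnInterval_jostCos (x y : ℝ) :
    AbsolutelyContinuousOnInterval (jostCos h hq k) x y := by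
  have h1 := (integrable_mul_jostMap h hq k (u := fun t => sinDiv k t)
    (by fun_prop)).absolutelyContinuousOnInterval_integral b x y
  have h2 := (contDiff_const (c := (1 : ℂ)) (n := 1) (𝕜 := ℝ) (E := ℝ)).contDiffOn (s := uIcc x y)
    |>.absolutelyContinuousOnInterval.fun_sub h1
  rwa [jostCos_eq_primitive]

theorem jostSin_eq_primitive : jostSin h hq k = fun t => Complex.I * k + ∫ v in b..t, (q v : ℂ) *
      (Complex.cos (k * v) * jostMap h hq k (projIcc a b h v)) := by
  funext t
  rw [jostSin, intervalIntegral.integral_symm b t]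
  ring

theorem absolutelyContinuousOnInterval_jostSin (x y : ℝ) :
    AbsolutelyContinuousOnInterval (jostSin h hq k) x y := by
  have h1 := (integrable_mul_jostMap h hq k (u := fun t : ℝ => Complex.cos (k * t))
    (by fun_prop)).absolutelyContinuousOnInterval_integral b x y
  have h2 := (contDiff_const (c := Complex.I * k) (n := 1) (𝕜 := ℝ) (E := ℝ)).contDiffOn
    (s := uIcc x y) |>.absolutelyContinuousOnInterval.fun_add h1
  rwa [jostSin_eq_primitive]

theorem ae_hasDerivAt_jostCos : ∀ᵐ t : ℝ, HasDerivAt (jostCos h hq k)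
    (-((q t : ℂ) * (sinDiv k t * jostMap h hq k (projIcc a b h t)))) t := by
  filter_upwards [_root_.LocallyIntegrable.ae_hasDerivAt_integral
    (integrable_mul_jostMap h hq k (u := fun t => sinDiv k t) (by fun_prop))] with t ht
  rw [jostCos_eq_primitive]
  exact (ht b).const_sub 1

theorem ae_hasDerivAt_jostSin : ∀ᵐ t : ℝ, HasDerivAt (jostSin h hq k)
    ((q t : ℂ) * (Complex.cos (k * t) * jostMap h hq k (projIcc a b h t))) t := by
  filter_upwards [_root_.LocallyIntegrable.ae_hasDerivAt_integral
    (integrable_mul_jostMap h hq k (u := fun t : ℝ => Complex.cos (k * t)) (by fun_prop))] with t ht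
  rw [jostSin_eq_primitive]
  exact (ht b).const_add (Complex.I * k)

theorem absolutelyContinuousOnInterval_jostSolDeriv (x y : ℝ) :
    AbsolutelyContinuousOnInterval (jostSolDeriv h hq k) x y := by
  have hS := ((absolutelyContinuousOnInterval_sinDiv k x y).const_smul (k ^ 2)).fun_neg
  exact ((absolutelyContinuousOnInterval_jostCos h hq k x y).mul_complex hS).fun_add
    ((absolutelyContinuousOnInterval_jostSin h hq k x y).mul_complex
      (absolutelyContinuousOnInterval_cos_mul k x y))

theorem hasDerivAt_jostSol (x : ℝ) :
    HasDerivAt (jostSol h hq k) (jostSolDeriv h hq k x) x := by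
  refine hasDerivAt_of_ae_hasDerivAt (fun x y => ?_)
    (continuous_of_absolutelyContinuousOnInterval
      (absolutelyContinuousOnInterval_jostSolDeriv h hq k)) ?_ x
  · exact ((absolutelyContinuousOnInterval_jostCos h hq k x y).mul_complex
      (absolutelyContinuousOnInterval_cos_mul k x y)).fun_add
        ((absolutelyContinuousOnInterval_jostSin h hq k x y).mul_complex
          (absolutelyContinuousOnInterval_sinDiv k x y))
  · filter_upwards [ae_hasDerivAt_jostCos h hq k, ae_hasDerivAt_jostSin h hq k] with t h1 h2
    have h3 := (h1.mul (hasDerivAt_cos_mul k t)).add (h2.mul (hasDerivAt_sinDiv k t))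
    refine h3.congr_deriv ?_
    rw [jostSolDeriv]
    ring

variable (hz : ∀ᵐ t, t ∉ Icc a b → q t = 0)
include hz

theorem ae_mul_jostMap_eq : ∀ᵐ t : ℝ,
    (q t : ℂ) * jostMap h hq k (projIcc a b h t) = (q t : ℂ) * jostSol h hq k t := by
  filter_upwards [hz] with t ht
  by_cases htm : t ∈ Icc a b
  · rw [jostSol_eq_jostMap h hq k htm]
  · simp [ht htm]

theorem jostCos_eq (x : ℝ) : jostCos h hq k x =
    1 + ∫ t in x..b, (q t : ℂ) * (sinDiv k t * jostSol h hq k t) := by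
  rw [jostCos]
  congr 1
  refine intervalIntegral.integral_congr_ae ?_
  filter_upwards [ae_mul_jostMap_eq h hq k hz] with t ht _
  linear_combination sinDiv k t * ht

theorem jostSin_eq (x : ℝ) : jostSin h hq k x =
    Complex.I * k - ∫ t in x..b, (q t : ℂ) * (Complex.cos (k * t) * jostSol h hq k t) := by
  rw [jostSin]
  congr 1
  refine intervalIntegral.integral_congr_ae ?_
  filter_upwards [ae_mul_jostMap_eq h hq k hz] with t ht _
  linear_combination Complex.cos (k * t) * ht

theorem integral_mul_eq_zero_of_le {u : ℝ → ℂ} {x : ℝ} (hx : b ≤ x) :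
    ∫ t in x..b, (q t : ℂ) * u t = 0 := by
  refine intervalIntegral.integral_zero_ae ?_
  filter_upwards [hz] with t ht htm
  rw [uIoc_of_ge hx] at htm
  rw [ht fun h => absurd h.2 (not_le.2 htm.1)]
  simp

theorem jostSol_of_le {x : ℝ} (hx : b ≤ x) :
    jostSol h hq k x = Complex.exp (Complex.I * x * k) := by
  rw [jostSol, jostCos, jostSin, integral_mul_eq_zero_of_le hz hx,
    integral_mul_eq_zero_of_le hz hx, exp_eq_cos_add_sinDiv]
  ring

theorem ae_hasDerivAt_jostSolDeriv : ∀ᵐ t : ℝ, HasDerivAt (jostSolDeriv h hq k)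
    (((q t : ℂ) - k ^ 2) * jostSol h hq k t) t := by
  filter_upwards [ae_hasDerivAt_jostCos h hq k, ae_hasDerivAt_jostSin h hq k,
    ae_mul_jostMap_eq h hq k hz] with t h1 h2 h3
  have h4 := (h1.mul ((hasDerivAt_sinDiv k t).const_mul (k ^ 2)).neg).add
    (h2.mul (hasDerivAt_cos_mul k t))
  refine h4.congr_deriv ?_
  have h5 := cos_sq_add_sinDiv_sq k t
  have h6 : jostSol h hq k t = jostCos h hq k t * Complex.cos (k * t) +
    jostSin h hq k t * sinDiv k t := rfl
  rw [sub_mul, ← h3, h6]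
  simp only [Pi.neg_apply]
  linear_combination (q t : ℂ) * jostMap h hq k (projIcc a b h t) * h5

theorem isJostPlus_jostSol : IsJostPlus q k (jostSol h hq k) := by
  have hd : deriv (jostSol h hq k) = jostSolDeriv h hq k :=
    funext fun x => (hasDerivAt_jostSol h hq k x).deriv
  refine ⟨⟨fun x => (hasDerivAt_jostSol h hq k x).differentiableAt, ?_, ?_⟩, ?_⟩
  · rw [hd]
    exact absolutelyContinuousOnInterval_jostSolDeriv h hq k
  · rw [hd]
    filter_upwards [ae_hasDerivAt_jostSolDeriv h hq k hz] with t ht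
    rw [ht.deriv]
    ring
  · filter_upwards [eventually_ge_atTop b] with x hx
    exact jostSol_of_le h hq k hz hx

end Existence

theorem locallyIntegrable_ofReal_sub_const {q : ℝ → ℝ} (hq : Integrable q volume) (c : ℂ) :
    LocallyIntegrable (fun t => (q t : ℂ) - c) volume :=
  hq.ofReal.locallyIntegrable.sub (locallyIntegrable_const _)

theorem intervalIntegrable_of_locallyIntegrable {E : Type*} [NormedAddCommGroup E] {u : ℝ → E}
    (hu : LocallyIntegrable u volume) (x y : ℝ) : IntervalIntegrable u volume x y :=
  (hu.integrableOn_isCompact isCompact_uIcc).intervalIntegrable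

namespace IsSchrodingerSolution

variable {q : ℝ → ℝ} {k l : ℂ} {f g : ℝ → ℂ}

theorem hasDerivAt (hf : IsSchrodingerSolution q k f) (x : ℝ) : HasDerivAt f (deriv f x) x :=
  (hf.differentiable x).hasDerivAt

theorem continuous_deriv (hf : IsSchrodingerSolution q k f) : Continuous (deriv f) :=
  continuous_of_absolutelyContinuousOnInterval hf.absolutelyContinuous

theorem ae_hasDerivAt_deriv (hf : IsSchrodingerSolution q k f) :
    ∀ᵐ x, HasDerivAt (deriv f) (((q x : ℂ) - k ^ 2) * f x) x := by
  filter_upwards [AbsolutelyContinuousOnInterval.ae_differentiableAt_complex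
    hf.absolutelyContinuous, hf.equation] with x h1 h2
  refine h1.hasDerivAt.congr_deriv ?_
  linear_combination -h2

theorem wronskian_eq (hf : IsSchrodingerSolution q k f) (hg : IsSchrodingerSolution q l g)
    (hkl : k ^ 2 = l ^ 2) (x y : ℝ) :
    f x * deriv g x - deriv f x * g x = f y * deriv g y - deriv f y * g y := by
  have hfa := absolutelyContinuousOnInterval_of_hasDerivAt hf.hasDerivAt hf.continuous_deriv x y
  have hga := absolutelyContinuousOnInterval_of_hasDerivAt hg.hasDerivAt hg.continuous_deriv x y
  refine eq_of_ae_hasDerivAt_zero (f := fun x => f x * deriv g x - deriv f x * g x)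
    ((hfa.mul_complex (hg.absolutelyContinuous x y)).fun_sub
      ((hf.absolutelyContinuous x y).mul_complex hga)) ?_
  filter_upwards [hf.ae_hasDerivAt_deriv, hg.ae_hasDerivAt_deriv] with t h1 h2 _
  refine (((hf.hasDerivAt t).mul h2).sub (h1.mul (hg.hasDerivAt t))).congr_deriv ?_
  rw [hkl]
  ring

theorem eq_of_eventuallyEq (hq : Integrable q volume) (hf : IsSchrodingerSolution q k f)
    (hg : IsSchrodingerSolution q k g) (h : f =ᶠ[atTop] g) : f = g := by
  obtain ⟨B, hB⟩ := eventually_atTop.1 h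
  ext a
  set b := max a (B + 1) with hb
  have hab : a ≤ b := le_max_left _ _
  have hBb : B < b := (lt_add_one B).trans_le (le_max_right _ _)
  set d : ℝ → ℂ := fun x => f x - g x with hd
  set d' : ℝ → ℂ := fun x => deriv f x - deriv g x with hd'
  have hdb : d b = 0 := sub_eq_zero.2 (hB b hBb.le)
  have hdb' : d' b = 0 := by
    have : f =ᶠ[𝓝 b] g := by
      filter_upwards [Ioi_mem_nhds hBb] with x hx using hB x (le_of_lt hx)
    exact sub_eq_zero.2 this.deriv_eq
  have hdd : ∀ t, HasDerivAt d (d' t) t := fun t => (hf.hasDerivAt t).sub (hg.hasDerivAt t)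
  have hdc' : Continuous d' := hf.continuous_deriv.sub hg.continuous_deriv
  have hdc : Continuous d := hf.differentiable.continuous.sub hg.differentiable.continuous
  have hql : LocallyIntegrable (fun t => ((q t : ℂ) - k ^ 2) * d t) volume :=
    (locallyIntegrable_ofReal_sub_const hq _).mul_continuous hdc
  have hd2 : ∀ᵐ t, HasDerivAt d' (((q t : ℂ) - k ^ 2) * d t) t := by
    filter_upwards [hf.ae_hasDerivAt_deriv, hg.ae_hasDerivAt_deriv] with t h1 h2
    refine (h1.sub h2).congr_deriv ?_
    simp only [hd]; ring
  have e1 : ∀ x, d x = -∫ t in x..b, d' t := fun x => by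
    rw [integral_eq_sub_of_ae_hasDerivAt
      (absolutelyContinuousOnInterval_of_hasDerivAt hdd hdc') hdc'.locallyIntegrable
      (Eventually.of_forall hdd), hdb]
    ring
  have e2 : ∀ x, d' x = -∫ t in x..b, ((q t : ℂ) - k ^ 2) * d t := fun x => by
    rw [integral_eq_sub_of_ae_hasDerivAt
      (fun u v => (hf.absolutelyContinuous u v).fun_sub (hg.absolutelyContinuous u v)) hql hd2]
    change d' x = -(d' b - d' x)
    rw [hdb']
    ring
  have hm : ∀ x y, IntervalIntegrable (fun t => 1 + ‖(q t : ℂ) - k ^ 2‖) volume x y := fun x y =>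
    intervalIntegrable_const.add (intervalIntegrable_of_locallyIntegrable
      (locallyIntegrable_ofReal_sub_const hq _) x y).norm
  have hy : Continuous fun x => ‖d x‖ + ‖d' x‖ := by fun_prop
  have key := le_mul_exp_of_le_add_integral (c := 0) (hm a b)
    (fun t => by positivity) hy.continuousOn (fun x hx => ?_) a ⟨le_rfl, hab⟩
  · have h0 : ‖d a‖ ≤ 0 := by linarith [norm_nonneg (d' a)]
    exact sub_eq_zero.1 (norm_le_zero_iff.1 h0)
  · have h1 : ‖d x‖ ≤ ∫ t in x..b, ‖d' t‖ := by
      rw [e1 x, norm_neg]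
      exact intervalIntegral.norm_integral_le_integral_norm hx.2
    have h2 : ‖d' x‖ ≤ ∫ t in x..b, ‖((q t : ℂ) - k ^ 2) * d t‖ := by
      rw [e2 x, norm_neg]
      exact intervalIntegral.norm_integral_le_integral_norm hx.2
    have i1 : IntervalIntegrable (fun t => ‖d' t‖) volume x b := hdc'.norm.intervalIntegrable _ _
    have i2 : IntervalIntegrable (fun t => ‖((q t : ℂ) - k ^ 2) * d t‖) volume x b :=
      (intervalIntegrable_of_locallyIntegrable hql x b).norm
    rw [zero_add]
    calc ‖d x‖ + ‖d' x‖ ≤ ∫ t in x..b, (‖d' t‖ + ‖((q t : ℂ) - k ^ 2) * d t‖) := by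
          rw [intervalIntegral.integral_add i1 i2]
          exact add_le_add h1 h2
      _ ≤ _ := by
          refine intervalIntegral.integral_mono_on hx.2 (i1.add i2)
            ((hm x b).mul_continuousOn hy.continuousOn) fun t _ => ?_
          rw [norm_mul]
          nlinarith [norm_nonneg (d t), norm_nonneg (d' t),
            mul_nonneg (norm_nonneg ((q t : ℂ) - k ^ 2)) (norm_nonneg (d' t))]

theorem conj {κ : ℝ} (hf : IsSchrodingerSolution q κ f) :
    IsSchrodingerSolution q κ fun x => starRingEnd ℂ (f x) := by
  have hd : ∀ x, HasDerivAt (fun x => starRingEnd ℂ (f x)) (starRingEnd ℂ (deriv f x)) x :=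
    fun x => (hf.hasDerivAt x).star
  have hdd : deriv (fun x => starRingEnd ℂ (f x)) = fun x => starRingEnd ℂ (deriv f x) :=
    funext fun x => (hd x).deriv
  refine ⟨fun x => (hd x).differentiableAt, fun a b => ?_, ?_⟩
  · rw [hdd]
    exact (Complex.isometry_conj.lipschitz.lipschitzOnWith
      (s := univ)).comp_absolutelyContinuousOnInterval (hf.absolutelyContinuous a b)
        fun _ _ => mem_univ _
  · rw [hdd]
    filter_upwards [hf.ae_hasDerivAt_deriv] with x hx
    have : HasDerivAt (fun x => starRingEnd ℂ (deriv f x))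
      (starRingEnd ℂ (((q x : ℂ) - κ ^ 2) * f x)) x := hx.star
    rw [this.deriv]
    simp
    ring

theorem comp_neg (hq : Integrable q volume) (hf : IsSchrodingerSolution q k f) :
    IsSchrodingerSolution (fun x => q (-x)) k fun x => f (-x) := by
  have hd : ∀ x, HasDerivAt (fun x => f (-x)) (-deriv f (-x)) x := fun x => by
    simpa [Function.comp_def] using (hf.hasDerivAt (-x)).scomp x (hasDerivAt_neg x)
  have hdd : deriv (fun x => f (-x)) = fun x => -deriv f (-x) := funext fun x => (hd x).deriv
  have hac : ∀ a b, AbsolutelyContinuousOnInterval (fun x => -deriv f (-x)) a b := by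
    have hl : LocallyIntegrable (fun t => ((q (-t) : ℂ) - k ^ 2) * f (-t)) volume :=
      (locallyIntegrable_ofReal_sub_const hq.comp_neg _).mul_continuous (hf.differentiable.continuous.comp continuous_neg)
    intro a b
    have e : (fun x => -deriv f (-x)) = fun x =>
        -deriv f 0 + ∫ t in (0 : ℝ)..x, ((q (-t) : ℂ) - k ^ 2) * f (-t) := by
      funext x
      rw [intervalIntegral.integral_comp_neg (fun t => ((q t : ℂ) - k ^ 2) * f t), neg_zero,
        integral_eq_sub_of_ae_hasDerivAt hf.absolutelyContinuous
          ((locallyIntegrable_ofReal_sub_const hq _).mul_continuous hf.differentiable.continuous)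
          hf.ae_hasDerivAt_deriv]
      ring
    rw [e]
    exact (contDiff_const.contDiffOn.absolutelyContinuousOnInterval).fun_add
      (hl.absolutelyContinuousOnInterval_integral 0 a b)
  refine ⟨fun x => (hd x).differentiableAt, ?_, ?_⟩
  · rwa [hdd]
  · rw [hdd]
    have := (Measure.measurePreserving_neg (volume : Measure ℝ)).quasiMeasurePreserving.ae
      hf.ae_hasDerivAt_deriv
    filter_upwards [this] with x hx
    have h2 : HasDerivAt (fun x => -deriv f (-x)) (((q (-x) : ℂ) - k ^ 2) * f (-x)) x := by
      have h3 := (hx.scomp x (hasDerivAt_neg x)).neg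
      rw [neg_smul, one_smul, neg_neg] at h3
      exact h3
    rw [h2.deriv]
    ring

end IsSchrodingerSolution

theorem ae_eq_zero_of_essSupport_subset {q : ℝ → ℝ} {s : Set ℝ} (h : essSupport q ⊆ s) :
    ∀ᵐ t, t ∉ s → q t = 0 := by
  have h1 : (volume.restrict (Function.support q)) (essSupport q)ᶜ = 0 :=
    Measure.measure_compl_support
  have hc : IsClosed (essSupport q) := Measure.isClosed_support
  rw [Measure.restrict_apply hc.measurableSet.compl] at h1
  filter_upwards [measure_eq_zero_iff_ae_notMem.1 h1] with t ht hts
  by_contra hqt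
  exact ht ⟨fun hh => hts (h hh), hqt⟩

theorem isJostMinus_iff {q : ℝ → ℝ} (hq : Integrable q volume) {k : ℂ} {f : ℝ → ℂ} :
    IsJostMinus q k f ↔ IsJostPlus (fun x => q (-x)) k (fun x => f (-x)) := by
  constructor
  · rintro ⟨h1, h2⟩
    refine ⟨h1.comp_neg hq, ?_⟩
    filter_upwards [tendsto_neg_atTop_atBot.eventually h2] with x hx
    rw [hx]
    push_cast
    ring_nf
  · rintro ⟨h1, h2⟩
    refine ⟨by simpa using h1.comp_neg hq.comp_neg, ?_⟩
    filter_upwards [tendsto_neg_atBot_atTop.eventually h2] with x hx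
    rw [neg_neg] at hx
    rw [hx]
    push_cast
    ring_nf

section Jost

variable {q : ℝ → ℝ} {a b : ℝ} (h : a ≤ b) (hq : Integrable q volume)
  (hz : ∀ᵐ t, t ∉ Icc a b → q t = 0) (k : ℂ)
include h hq hz

theorem existsUnique_isJostPlus : ∃! f : ℝ → ℂ, IsJostPlus q k f := by
  refine ⟨jostSol h hq k, isJostPlus_jostSol h hq k hz, fun g hg => ?_⟩
  refine hg.1.eq_of_eventuallyEq hq (isJostPlus_jostSol h hq k hz).1 ?_
  filter_upwards [hg.2, (isJostPlus_jostSol h hq k hz).2] with x h1 h2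
  rw [h1, h2]

theorem isJostPlus_jostPlus : IsJostPlus q k fun x => jostPlus q x k :=
  Classical.epsilon_spec (existsUnique_isJostPlus h hq hz k).exists

theorem jostPlus_eq (x : ℝ) : jostPlus q x k = jostSol h hq k x :=
  congrFun ((existsUnique_isJostPlus h hq hz k).unique (isJostPlus_jostPlus h hq hz k)
    (isJostPlus_jostSol h hq k hz)) x

theorem jostPlusDeriv_eq (x : ℝ) : jostPlusDeriv q x k = jostSolDeriv h hq k x := by
  rw [jostPlusDeriv, funext (jostPlus_eq h hq hz k)]
  exact (hasDerivAt_jostSol h hq k x).deriv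

theorem differentiable_jostPlus_zero (ha : a ≤ 0) (hb : 0 ≤ b) :
    Differentiable ℂ (jostPlus q 0) := by
  have e : jostPlus q 0 = fun k => ContinuousMap.evalCLM ℂ (⟨0, ha, hb⟩ : Icc a b)
      (jostMap h hq k) := by
    funext k
    rw [jostPlus_eq h hq hz, jostSol_eq_jostMap h hq k ⟨ha, hb⟩, projIcc_of_mem h ⟨ha, hb⟩]
    rfl
  rw [e]
  exact (ContinuousLinearMap.differentiable _).comp (differentiable_jostMap h hq)

theorem differentiable_jostPlusDeriv_zero (ha : a ≤ 0) (hb : 0 ≤ b) :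
    Differentiable ℂ (jostPlusDeriv q 0) := by
  have e : jostPlusDeriv q 0 = fun k => Complex.I * k -
      ContinuousMap.evalCLM ℂ (⟨0, ha, hb⟩ : Icc a b)
        (tailIntegral h hq (cosMap a b k * jostMap h hq k)) := by
    funext k
    rw [jostPlusDeriv_eq h hq hz, jostSolDeriv]
    simp only [sinDiv_apply_zero, Complex.ofReal_zero, mul_zero, Complex.cos_zero, neg_zero,
      mul_one, zero_add, jostSin]
    congr 1
    refine intervalIntegral.integral_congr fun t ht => ?_
    rw [uIcc_of_le hb] at ht
    rw [projIcc_of_mem h ⟨ha.trans ht.1, ht.2⟩]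
    rfl
  rw [e]
  refine (differentiable_id.const_mul _).sub ?_
  exact ((ContinuousLinearMap.differentiable _).comp (ContinuousLinearMap.differentiable _)).comp
    (differentiable_cosMap.mul (differentiable_jostMap h hq))

omit h hq in
theorem ae_eq_zero_comp_neg : ∀ᵐ t, t ∉ Icc (-b) (-a) → q (-t) = 0 := by
  filter_upwards [(Measure.measurePreserving_neg (volume : Measure ℝ)).quasiMeasurePreserving.ae hz]
    with t ht htm
  exact ht fun hm => htm ⟨by linarith [hm.2], by linarith [hm.1]⟩

theorem existsUnique_isJostMinus : ∃! f : ℝ → ℂ, IsJostMinus q k f := by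
  obtain ⟨f, hf, hu⟩ := existsUnique_isJostPlus (neg_le_neg h) hq.comp_neg
    (ae_eq_zero_comp_neg hz) k
  refine ⟨fun x => f (-x), (isJostMinus_iff hq).2 (by simpa using hf), fun g hg => ?_⟩
  funext x
  have := congrFun (hu _ ((isJostMinus_iff hq).1 hg)) (-x)
  simpa using this

theorem isJostMinus_jostMinus : IsJostMinus q k fun x => jostMinus q x k :=
  Classical.epsilon_spec (existsUnique_isJostMinus h hq hz k).exists

theorem jostMinus_eq (x : ℝ) : jostMinus q x k = jostPlus (fun x => q (-x)) (-x) k := by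
  have h1 := isJostPlus_jostPlus (neg_le_neg h) hq.comp_neg (ae_eq_zero_comp_neg hz) k
  have h2 : IsJostMinus q k fun x => jostPlus (fun x => q (-x)) (-x) k :=
    (isJostMinus_iff hq).2 (by simpa using h1)
  exact congrFun ((existsUnique_isJostMinus h hq hz k).unique (isJostMinus_jostMinus h hq hz k) h2) x

theorem jostMinusDeriv_eq (x : ℝ) :
    jostMinusDeriv q x k = -jostPlusDeriv (fun x => q (-x)) (-x) k := by
  rw [jostMinusDeriv, funext (jostMinus_eq h hq hz k)]
  exact deriv_comp_neg (fun t => jostPlus (fun x => q (-x)) t k) x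

theorem jostWronskianAt_eq (x : ℝ) : jostWronskianAt q x k = jostWronskian q k :=
  (isJostMinus_jostMinus h hq hz k).1.wronskian_eq (isJostPlus_jostPlus h hq hz k).1 rfl x 0

theorem differentiable_jostWronskian (ha : a ≤ 0) (hb : 0 ≤ b) :
    Differentiable ℂ (jostWronskian q) := by
  have hz' := ae_eq_zero_comp_neg hz
  have e : jostWronskian q = fun k => jostPlus (fun x => q (-x)) 0 k * jostPlusDeriv q 0 k +
      jostPlusDeriv (fun x => q (-x)) 0 k * jostPlus q 0 k := by
    funext k
    rw [jostWronskian, jostWronskianAt, jostMinus_eq h hq hz, jostMinusDeriv_eq h hq hz, neg_zero]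
    ring
  have hb' : -b ≤ 0 := by linarith
  have ha' : 0 ≤ -a := by linarith
  rw [e]
  exact ((differentiable_jostPlus_zero (neg_le_neg h) hq.comp_neg hz' hb' ha').mul
    (differentiable_jostPlusDeriv_zero h hq hz ha hb)).add
      ((differentiable_jostPlusDeriv_zero (neg_le_neg h) hq.comp_neg hz' hb' ha').mul
        (differentiable_jostPlus_zero h hq hz ha hb))

end Jost

theorem norm_exp_I_mul (x : ℝ) (k : ℂ) :
    ‖Complex.exp (Complex.I * x * k)‖ = Real.exp (-k.im * x) := by
  rw [Complex.norm_exp]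
  simp [mul_comm]

theorem norm_sin_le (z : ℂ) : ‖Complex.sin z‖ ≤ Real.exp |z.im| := by
  have h1 : ‖Complex.exp (-z * Complex.I)‖ ≤ Real.exp |z.im| := by
    rw [Complex.norm_exp]
    simpa using le_abs_self z.im
  have h2 : ‖Complex.exp (z * Complex.I)‖ ≤ Real.exp |z.im| := by
    rw [Complex.norm_exp]
    simpa using neg_le_abs z.im
  rw [Complex.sin, norm_div, norm_mul, Complex.norm_I, mul_one]
  have := norm_sub_le (Complex.exp (-z * Complex.I)) (Complex.exp (z * Complex.I))
  rw [Complex.norm_ofNat]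
  linarith

theorem norm_cos_le (z : ℂ) : ‖Complex.cos z‖ ≤ Real.exp |z.im| := by
  have h1 : ‖Complex.exp (-z * Complex.I)‖ ≤ Real.exp |z.im| := by
    rw [Complex.norm_exp]
    simpa using le_abs_self z.im
  have h2 : ‖Complex.exp (z * Complex.I)‖ ≤ Real.exp |z.im| := by
    rw [Complex.norm_exp]
    simpa using neg_le_abs z.im
  rw [Complex.cos, norm_div, Complex.norm_ofNat]
  have := norm_add_le (Complex.exp (z * Complex.I)) (Complex.exp (-z * Complex.I))
  linarith

section Estimates

variable {q : ℝ → ℝ} {γ : ℝ} (h : 0 ≤ γ) (hq : Integrable q volume)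
  (hz : ∀ᵐ t, t ∉ Icc 0 γ → q t = 0) {k : ℂ}
include h hq hz

theorem jostSol_eq_exp_add (k : ℂ) (x : ℝ) : jostSol h hq k x = Complex.exp (Complex.I * x * k) +
    ∫ t in x..γ, (q t : ℂ) * ((sinDiv k t * Complex.cos (k * x) - Complex.cos (k * t) * sinDiv k x) *
      jostSol h hq k t) := by
  have hc : Continuous (jostSol h hq k) :=
    (isJostPlus_jostSol h hq k hz).1.differentiable.continuous
  have e : ∫ t in x..γ, (q t : ℂ) * ((sinDiv k t * Complex.cos (k * x) -
      Complex.cos (k * t) * sinDiv k x) * jostSol h hq k t) =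
      (∫ t in x..γ, (q t : ℂ) * (sinDiv k t * jostSol h hq k t)) * Complex.cos (k * x) -
      (∫ t in x..γ, (q t : ℂ) * (Complex.cos (k * t) * jostSol h hq k t)) * sinDiv k x := by
    rw [← intervalIntegral.integral_mul_const, ← intervalIntegral.integral_mul_const,
      ← intervalIntegral.integral_sub]
    · congr 1; ext t; ring
    · exact (intervalIntegrable_ofReal_mul hq (by fun_prop) _ _).mul_const _
    · exact (intervalIntegrable_ofReal_mul hq (by fun_prop) _ _).mul_const _
  rw [e]
  conv_lhs => rw [jostSol, jostCos_eq h hq k hz, jostSin_eq h hq k hz]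
  rw [exp_eq_cos_add_sinDiv]
  ring

theorem exp_mul_norm_jostSol_le (hk : k ≠ 0) : ∀ x ∈ Icc 0 γ,
    Real.exp (|k.im| * x) * ‖jostSol h hq k x‖ ≤
      Real.exp (γ * (|k.im| - k.im)) * Real.exp (‖k‖⁻¹ * ∫ t in x..γ, |q t|) := by
  have hc : Continuous (jostSol h hq k) :=
    (isJostPlus_jostSol h hq k hz).1.differentiable.continuous
  have hm : IntervalIntegrable (fun t => ‖k‖⁻¹ * |q t|) volume 0 γ :=
    hq.abs.intervalIntegrable.const_mul _
  have hy : Continuous fun x : ℝ => Real.exp (|k.im| * x) * ‖jostSol h hq k x‖ := by fun_prop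
  have key := le_mul_exp_of_le_add_integral (c := Real.exp (γ * (|k.im| - k.im))) hm
    (fun t => by positivity) hy.continuousOn fun x hx => ?_
  · intro x hx
    have := key x hx
    rwa [intervalIntegral.integral_const_mul] at this
  have hbound : ‖∫ t in x..γ, (q t : ℂ) * ((sinDiv k t * Complex.cos (k * x) -
      Complex.cos (k * t) * sinDiv k x) * jostSol h hq k t)‖ ≤
      ∫ t in x..γ, Real.exp (-(|k.im| * x)) *
        (‖k‖⁻¹ * |q t| * (Real.exp (|k.im| * t) * ‖jostSol h hq k t‖)) := by
    refine (intervalIntegral.norm_integral_le_integral_norm hx.2).trans ?_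
    refine intervalIntegral.integral_mono_on hx.2
      (intervalIntegrable_ofReal_mul hq (by fun_prop) _ _).norm
      (((hq.abs.intervalIntegrable.const_mul _).mul_continuousOn hy.continuousOn).const_mul _)
      fun t ht => ?_
    have h1 : sinDiv k t * Complex.cos (k * x) - Complex.cos (k * t) * sinDiv k x =
        Complex.sin (k * (t - x : ℝ)) / k := by
      rw [sinDiv_of_ne hk, sinDiv_of_ne hk, Complex.ofReal_sub, mul_sub, Complex.sin_sub]
      field_simp
    have h2 : ‖Complex.sin (k * (t - x : ℝ))‖ ≤ Real.exp (|k.im| * (t - x)) := by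
      refine (norm_sin_le _).trans (le_of_eq ?_)
      rw [Complex.im_mul_ofReal, abs_mul, abs_of_nonneg (sub_nonneg.2 ht.1)]
    rw [norm_mul, norm_mul, h1, norm_div, Complex.norm_real, Real.norm_eq_abs, div_eq_mul_inv]
    calc |q t| * (‖Complex.sin (k * (t - x : ℝ))‖ * ‖k‖⁻¹ * ‖jostSol h hq k t‖)
        ≤ |q t| * (Real.exp (|k.im| * (t - x)) * ‖k‖⁻¹ * ‖jostSol h hq k t‖) := by gcongr
      _ = _ := by
        rw [show |k.im| * (t - x) = -(|k.im| * x) + |k.im| * t by ring, Real.exp_add]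
        ring
  rw [intervalIntegral.integral_const_mul] at hbound
  have h3 : ‖jostSol h hq k x‖ ≤ Real.exp (-k.im * x) + Real.exp (-(|k.im| * x)) *
      ∫ t in x..γ, ‖k‖⁻¹ * |q t| * (Real.exp (|k.im| * t) * ‖jostSol h hq k t‖) := by
    conv_lhs => rw [jostSol_eq_exp_add h hq hz]
    refine (norm_add_le _ _).trans ?_
    rw [norm_exp_I_mul]
    gcongr
  calc Real.exp (|k.im| * x) * ‖jostSol h hq k x‖
      ≤ Real.exp (|k.im| * x) * (Real.exp (-k.im * x) + Real.exp (-(|k.im| * x)) *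
        ∫ t in x..γ, ‖k‖⁻¹ * |q t| * (Real.exp (|k.im| * t) * ‖jostSol h hq k t‖)) := by gcongr
    _ = Real.exp (x * (|k.im| - k.im)) +
        ∫ t in x..γ, ‖k‖⁻¹ * |q t| * (Real.exp (|k.im| * t) * ‖jostSol h hq k t‖) := by
      rw [mul_add, ← mul_assoc, ← Real.exp_add, ← Real.exp_add]
      rw [add_neg_cancel, Real.exp_zero, one_mul]
      congr 2
      ring
    _ ≤ _ := by
      gcongr
      · linarith [le_abs_self k.im]
      · exact hx.2

theorem norm_jostPlus_zero_le (hk : k ≠ 0) : ‖jostPlus q 0 k‖ ≤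
    Real.exp (γ * (|k.im| - k.im)) * Real.exp (‖k‖⁻¹ * potentialNorm q) := by
  have h1 := exp_mul_norm_jostSol_le h hq hz hk 0 ⟨le_rfl, h⟩
  rw [mul_zero, Real.exp_zero, one_mul, ← jostPlus_eq h hq hz] at h1
  refine h1.trans ?_
  gcongr
  rw [intervalIntegral.integral_of_le h]
  exact setIntegral_le_integral hq.abs (Eventually.of_forall fun t => abs_nonneg _)

theorem norm_jostPlusDeriv_zero_le (hk : k ≠ 0) : ‖jostPlusDeriv q 0 k‖ ≤
    ‖k‖ * (Real.exp (γ * (|k.im| - k.im)) * Real.exp (‖k‖⁻¹ * potentialNorm q)) := by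
  have hk0 : 0 < ‖k‖ := norm_pos_iff.2 hk
  have hc : Continuous (jostSol h hq k) :=
    (isJostPlus_jostSol h hq k hz).1.differentiable.continuous
  have hA : Continuous fun t => Real.exp (‖k‖⁻¹ * ∫ s in t..γ, |q s|) :=
    ((continuous_integral_left (fun _ _ => hq.abs.intervalIntegrable) γ).const_smul
      ‖k‖⁻¹).rexp
  set E := Real.exp (γ * (|k.im| - k.im)) with hE
  have hE1 : 1 ≤ E := Real.one_le_exp (mul_nonneg h (by linarith [le_abs_self k.im]))
  have e : jostPlusDeriv q 0 k = Complex.I * k -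
      ∫ t in (0 : ℝ)..γ, (q t : ℂ) * (Complex.cos (k * t) * jostSol h hq k t) := by
    rw [jostPlusDeriv_eq h hq hz, jostSolDeriv, jostSin_eq h hq k hz]
    simp
  have hint : ‖∫ t in (0 : ℝ)..γ, (q t : ℂ) * (Complex.cos (k * t) * jostSol h hq k t)‖ ≤
      ∫ t in (0 : ℝ)..γ, E * (|q t| * Real.exp (‖k‖⁻¹ * ∫ s in t..γ, |q s|)) := by
    refine (intervalIntegral.norm_integral_le_integral_norm h).trans ?_
    refine intervalIntegral.integral_mono_on h
      (intervalIntegrable_ofReal_mul hq (by fun_prop) _ _).norm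
      ((hq.abs.intervalIntegrable.mul_continuousOn hA.continuousOn).const_mul _) fun t ht => ?_
    rw [norm_mul, norm_mul, Complex.norm_real, Real.norm_eq_abs]
    have h2 : ‖Complex.cos (k * t)‖ ≤ Real.exp (|k.im| * t) := by
      refine (norm_cos_le _).trans (le_of_eq ?_)
      rw [Complex.im_mul_ofReal, abs_mul, abs_of_nonneg ht.1]
    calc |q t| * (‖Complex.cos (k * t)‖ * ‖jostSol h hq k t‖)
        ≤ |q t| * (Real.exp (|k.im| * t) * ‖jostSol h hq k t‖) := by gcongr
      _ ≤ |q t| * (E * Real.exp (‖k‖⁻¹ * ∫ s in t..γ, |q s|)) :=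
        mul_le_mul_of_nonneg_left (exp_mul_norm_jostSol_le h hq hz hk t ht) (abs_nonneg _)
      _ = _ := by ring
  rw [intervalIntegral.integral_const_mul,
    integral_mul_exp_primitive hq.abs.intervalIntegrable (inv_ne_zero hk0.ne'), div_inv_eq_mul]
    at hint
  have hN : Real.exp (‖k‖⁻¹ * ∫ s in (0 : ℝ)..γ, |q s|) ≤
      Real.exp (‖k‖⁻¹ * potentialNorm q) := by
    gcongr
    rw [intervalIntegral.integral_of_le h]
    exact setIntegral_le_integral hq.abs (Eventually.of_forall fun t => abs_nonneg _)
  rw [e]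
  refine (norm_sub_le _ _).trans ?_
  rw [norm_mul, Complex.norm_I, one_mul]
  have h4 := mul_le_mul_of_nonneg_left hN (by positivity : (0 : ℝ) ≤ E * ‖k‖)
  nlinarith [mul_le_mul_of_nonneg_right hE1 hk0.le]

theorem jostWronskian_eq_of_nonneg (k : ℂ) :
    jostWronskian q k = jostPlusDeriv q 0 k + Complex.I * k * jostPlus q 0 k := by
  have hz' := ae_eq_zero_comp_neg hz
  have h0 : (-γ : ℝ) ≤ -0 := neg_le_neg h
  have e1 : jostPlus (fun x => q (-x)) 0 k = 1 := by
    have := jostSol_of_le h0 hq.comp_neg k hz' (x := 0) (by simp)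
    rw [jostPlus_eq h0 hq.comp_neg hz', this]
    simp
  have e2 : jostPlusDeriv (fun x => q (-x)) 0 k = Complex.I * k := by
    rw [jostPlusDeriv_eq h0 hq.comp_neg hz', jostSolDeriv, jostSin,
      integral_mul_eq_zero_of_le hz' (by simp)]
    simp
  rw [jostWronskian, jostWronskianAt, jostMinus_eq h hq hz, jostMinusDeriv_eq h hq hz, neg_zero,
    e1, e2]
  ring

theorem norm_jostWronskian_le (hk : k ≠ 0) : ‖jostWronskian q k‖ ≤
    2 * ‖k‖ * (Real.exp (γ * (|k.im| - k.im)) * Real.exp (‖k‖⁻¹ * potentialNorm q)) := by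
  rw [jostWronskian_eq_of_nonneg h hq hz]
  refine (norm_add_le _ _).trans ?_
  rw [norm_mul, norm_mul, Complex.norm_I, one_mul]
  have h1 := norm_jostPlusDeriv_zero_le h hq hz hk
  have h2 := mul_le_mul_of_nonneg_left (norm_jostPlus_zero_le h hq hz hk) (norm_nonneg k)
  linarith

/-- On the real axis, the Wronskian of the Jost solution and its conjugate. -/
theorem conj_jostPlus_mul_sub (κ : ℝ) :
    starRingEnd ℂ (jostPlus q 0 κ) * jostPlusDeriv q 0 κ -
      starRingEnd ℂ (jostPlusDeriv q 0 κ) * jostPlus q 0 κ = 2 * Complex.I * κ := by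
  have hs := (isJostPlus_jostSol h hq κ hz).1
  have hd : ∀ x, deriv (jostSol h hq κ) x = jostSolDeriv h hq κ x := fun x =>
    (hasDerivAt_jostSol h hq κ x).deriv
  have hdc : ∀ x, deriv (fun x => starRingEnd ℂ (jostSol h hq κ x)) x =
      starRingEnd ℂ (jostSolDeriv h hq κ x) := fun x => (hasDerivAt_jostSol h hq κ x).star.deriv
  have hw := hs.conj.wronskian_eq hs rfl 0 γ
  rw [hd, hd, hdc, hdc, ← jostPlus_eq h hq hz, ← jostPlusDeriv_eq h hq hz] at hw
  rw [hw, jostSol, jostSolDeriv, jostCos, jostSin]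
  simp only [intervalIntegral.integral_same, add_zero, sub_zero, one_mul]
  have hC : starRingEnd ℂ (Complex.cos (κ * γ)) = Complex.cos (κ * γ) := by
    rw [← Complex.cos_conj]; simp
  have hS : starRingEnd ℂ (sinDiv κ γ) = sinDiv κ γ := by
    rcases eq_or_ne (κ : ℂ) 0 with h0 | h0
    · simp [h0, sinDiv_zero]
    · rw [sinDiv_of_ne h0, map_div₀, ← Complex.sin_conj]; simp
  simp only [map_add, map_mul, map_neg, map_pow, hC, hS, Complex.conj_ofReal, Complex.conj_I]
  linear_combination 2 * Complex.I * κ * cos_sq_add_sinDiv_sq κ γ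

theorem le_norm_jostPlus_mul (κ : ℝ) :
    κ ≤ ‖jostPlus q 0 κ * jostPlusDeriv q 0 κ‖ := by
  have h1 := congrArg norm (conj_jostPlus_mul_sub h hq hz κ)
  have h2 := norm_sub_le (starRingEnd ℂ (jostPlus q 0 κ) * jostPlusDeriv q 0 κ)
    (starRingEnd ℂ (jostPlusDeriv q 0 κ) * jostPlus q 0 κ)
  rw [h1] at h2
  simp only [norm_mul, RCLike.norm_conj, Complex.norm_I, Complex.norm_real, Complex.norm_ofNat,
    Real.norm_eq_abs, mul_one] at h2 ⊢
  linarith [le_abs_self κ]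

theorem le_norm_jostWronskian (κ : ℝ) : 2 * κ ≤ ‖jostWronskian q κ‖ := by
  have h1 := conj_jostPlus_mul_sub h hq hz κ
  rw [jostWronskian_eq_of_nonneg h hq hz]
  set u := jostPlus q 0 κ
  set v := jostPlusDeriv q 0 κ
  have h2 := congrArg Complex.im h1
  simp at h2
  refine le_of_sq_le_sq ?_ (norm_nonneg _)
  rw [← Complex.normSq_eq_norm_sq, Complex.normSq_apply]
  simp
  have h3 : κ * (u.re * v.im - u.im * v.re) = κ * κ := by
    congr 1
    linarith
  nlinarith [sq_nonneg (κ * u.re - v.im), sq_nonneg (κ * u.im + v.re)]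

end Estimates

theorem integral_abs_sin_sub_sin :
    ∫ θ in (0 : ℝ)..2 * Real.pi, (|Real.sin θ| - Real.sin θ) = 4 := by
  have hi : ∀ x y, IntervalIntegrable (fun θ => |Real.sin θ| - Real.sin θ) volume x y :=
    fun x y => (by fun_prop : Continuous fun θ => |Real.sin θ| - Real.sin θ).intervalIntegrable _ _
  rw [← intervalIntegral.integral_add_adjacent_intervals (hi 0 Real.pi) (hi Real.pi _)]
  have h1 : ∫ θ in (0 : ℝ)..Real.pi, (|Real.sin θ| - Real.sin θ) = 0 := by
    rw [intervalIntegral.integral_congr (g := fun _ => 0), intervalIntegral.integral_zero]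
    intro θ hθ
    rw [uIcc_of_le Real.pi_pos.le] at hθ
    simp [abs_of_nonneg (Real.sin_nonneg_of_mem_Icc hθ)]
  have h2 : ∫ θ in Real.pi..2 * Real.pi, (|Real.sin θ| - Real.sin θ) =
      ∫ θ in Real.pi..2 * Real.pi, -2 * Real.sin θ := by
    refine intervalIntegral.integral_congr fun θ hθ => ?_
    rw [uIcc_of_le (by linarith [Real.pi_pos])] at hθ
    have : 0 ≤ Real.sin (θ - Real.pi) :=
      Real.sin_nonneg_of_mem_Icc ⟨by linarith [hθ.1], by linarith [hθ.2]⟩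
    rw [Real.sin_sub_pi] at this
    rw [abs_of_nonpos (by linarith)]
    ring
  rw [h1, h2, intervalIntegral.integral_const_mul, integral_sin]
  simp
  norm_num

theorem circleAverage_abs_im_sub_im {R : ℝ} (hR : 0 ≤ R) (c : ℝ) (α β : ℝ) :
    Real.circleAverage (fun z : ℂ => α * (|z.im| - z.im) + β) c R = α * (2 * R / Real.pi) + β := by
  rw [Real.circleAverage_def]
  have e : ∀ θ : ℝ, α * (|(circleMap c R θ).im| - (circleMap c R θ).im) + β =
      α * R * (|Real.sin θ| - Real.sin θ) + β := by
    intro θ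
    have : (circleMap c R θ).im = R * Real.sin θ := by
      simp [circleMap, Complex.exp_ofReal_mul_I_im]
    rw [this, abs_mul, abs_of_nonneg hR]
    ring
  simp_rw [e]
  rw [intervalIntegral.integral_add (((by fun_prop : Continuous fun θ : ℝ =>
      α * R * (|Real.sin θ| - Real.sin θ))).intervalIntegrable _ _) intervalIntegrable_const,
    intervalIntegral.integral_const_mul, integral_abs_sin_sub_sin,
    intervalIntegral.integral_const]
  have := Real.pi_pos.ne'
  simp only [smul_eq_mul]
  field_simp
  ring

/-- Jensen's bound for the number of zeros of an entire function. -/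
theorem zeroCount_le_circleAverage {F : ℂ → ℂ} (hF : Differentiable ℂ F) {c : ℂ} (hc : 1 ≤ ‖F c‖)
    {r ρ : ℝ} (hρ : 0 < ρ) (hsub : Metric.closedBall 0 r ⊆ Metric.closedBall c ρ) :
    zeroCount r F ≤ ENNReal.ofReal
      (1 / Real.log 2 * Real.circleAverage (fun z => Real.log ‖F z‖) c (2 * ρ)) := by
  have hlog2 : 0 < Real.log 2 := Real.log_pos one_lt_two
  have hFc : F c ≠ 0 := norm_pos_iff.1 (one_pos.trans_le hc)
  have han : AnalyticOnNhd ℂ F univ := hF.differentiableOn.analyticOnNhd isOpen_univ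
  have habs : |2 * ρ| = 2 * ρ := abs_of_pos (by positivity)
  have hanR : AnalyticOnNhd ℂ F (Metric.closedBall c |2 * ρ|) := han.mono (subset_univ _)
  have hJ := hanR.circleAverage_log_norm (by positivity) hFc
  set D := MeromorphicOn.divisor F (Metric.closedBall c |2 * ρ|) with hD
  have htop : ∀ z, analyticOrderAt F z ≠ ⊤ := by
    intro z hz
    have := han.eqOn_zero_of_preconnected_of_eventuallyEq_zero isPreconnected_univ (mem_univ z)
      (analyticOrderAt_eq_top.1 hz)
    exact hFc (this (mem_univ c))
  have hDz : ∀ z ∈ Metric.closedBall c (2 * ρ), (D z : ℝ) = (analyticOrderNatAt F z : ℝ) := by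
    intro z hz
    rw [hD, MeromorphicOn.AnalyticOnNhd.divisor_apply hanR (by rwa [habs]), ← Nat.cast_analyticOrderNatAt (htop z)]
    rfl
  set t : ℂ → ℝ := fun u => D u * Real.log (2 * ρ * ‖c - u‖⁻¹) with ht
  have hfin : t.support.Finite :=
    (D.finiteSupport (isCompact_closedBall c |2 * ρ|)).subset fun u hu => by
      simp only [ht, Function.mem_support] at hu ⊢
      intro h0
      exact hu (by rw [h0]; simp)
  have ht0 : ∀ u, 0 ≤ t u := by
    intro u
    by_cases hu : u ∈ Metric.closedBall c (2 * ρ)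
    · simp only [ht]
      rw [hDz u hu]
      refine mul_nonneg (Nat.cast_nonneg _) ?_
      rcases eq_or_ne u c with rfl | huc
      · simp
      · refine Real.log_nonneg ?_
        have h1 : 0 < ‖c - u‖ := norm_pos_iff.2 (sub_ne_zero.2 huc.symm)
        rw [← div_eq_mul_inv, one_le_div h1]
        rwa [Metric.mem_closedBall, dist_eq_norm'] at hu
    · have : D u = 0 := D.apply_eq_zero_of_notMem (by rwa [habs])
      simp [ht, this]
  have hle : ∀ z ∈ Metric.closedBall (0 : ℂ) r, (analyticOrderNatAt F z : ℝ) * Real.log 2 ≤ t z := by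
    intro z hz
    have hzρ := hsub hz
    rw [Metric.mem_closedBall, dist_eq_norm'] at hzρ
    have hz2 : z ∈ Metric.closedBall c (2 * ρ) := by
      rw [Metric.mem_closedBall, dist_eq_norm']; linarith
    simp only [ht]
    rw [hDz z hz2]
    rcases eq_or_ne z c with rfl | hzc
    · have : analyticOrderAt F z = 0 := (han z (mem_univ z)).analyticOrderAt_eq_zero.2 hFc
      simp [analyticOrderNatAt, this]
    · refine mul_le_mul_of_nonneg_left (Real.log_le_log two_pos ?_) (Nat.cast_nonneg _)
      have h1 : 0 < ‖c - z‖ := norm_pos_iff.2 (sub_ne_zero.2 hzc.symm)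
      rw [← div_eq_mul_inv, le_div_iff₀ h1]
      linarith
  have hsum : ∑ᶠ u, t u ≤ Real.circleAverage (fun z => Real.log ‖F z‖) c (2 * ρ) := by
    rw [hJ]
    linarith [Real.log_nonneg hc]
  rw [zeroCount, ENNReal.tsum_eq_iSup_sum]
  refine iSup_le fun s => ?_
  have e : ∀ z : Metric.closedBall (0 : ℂ) r,
      ((analyticOrderAt F (z : ℂ) : ℕ∞) : ℝ≥0∞) =
        ENNReal.ofReal (analyticOrderNatAt F (z : ℂ) : ℝ) := by
    intro z
    rw [← Nat.cast_analyticOrderNatAt (htop z), ENNReal.ofReal_natCast]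
    simp
  simp_rw [e]
  rw [← ENNReal.ofReal_sum_of_nonneg fun _ _ => Nat.cast_nonneg _]
  refine ENNReal.ofReal_le_ofReal ?_
  rw [one_div, inv_mul_eq_div, le_div_iff₀ hlog2, Finset.sum_mul]
  refine le_trans ?_ hsum
  classical
  rw [finsum_eq_sum_of_support_subset (s := hfin.toFinset ∪ s.image Subtype.val) t
    (fun u hu => by simp [Function.mem_support.1 hu])]
  calc ∑ z ∈ s, (analyticOrderNatAt F (z : ℂ) : ℝ) * Real.log 2 ≤ ∑ z ∈ s, t z :=
        Finset.sum_le_sum fun z _ => hle z z.2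
    _ = ∑ u ∈ s.image Subtype.val, t u := by
        rw [Finset.sum_image Subtype.val_injective.injOn]
    _ ≤ _ := Finset.sum_le_sum_of_subset_of_nonneg Finset.subset_union_right fun u _ _ => ht0 u

theorem zeroCount_le {F : ℂ → ℂ} (hF : Differentiable ℂ F) {c : ℝ} (hc : 1 ≤ ‖F c‖)
    {r ρ α β : ℝ} (hρ : 0 < ρ) (hsub : Metric.closedBall 0 r ⊆ Metric.closedBall (c : ℂ) ρ)
    (hα : 0 ≤ α) (hβ : 0 ≤ β) (hb : ∀ z : ℂ, ‖z - c‖ = 2 * ρ →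
      ‖F z‖ ≤ Real.exp (α * (|z.im| - z.im) + β)) :
    zeroCount r F ≤ ENNReal.ofReal (1 / Real.log 2 * (α * (4 * ρ / Real.pi) + β)) := by
  refine (zeroCount_le_circleAverage hF hc hρ hsub).trans (ENNReal.ofReal_le_ofReal ?_)
  have hlog2 : 0 < Real.log 2 := Real.log_pos one_lt_two
  refine mul_le_mul_of_nonneg_left ?_ (by positivity)
  have hR : 0 ≤ 2 * ρ := by positivity
  have h1 := circleAverage_abs_im_sub_im hR c α β
  rw [show 4 * ρ = 2 * (2 * ρ) by ring, ← h1]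
  refine Real.circleAverage_mono ?_ ?_ fun z hz => ?_
  · exact MeromorphicOn.circleIntegrable_log_norm fun z _ =>
      (hF.differentiableOn.analyticOnNhd isOpen_univ z (mem_univ z)).meromorphicAt
  · exact ContinuousOn.circleIntegrable hR (by fun_prop)
  · rw [abs_of_nonneg hR, mem_sphere_iff_norm] at hz
    rcases eq_or_ne (F z) 0 with h0 | h0
    · rw [h0, norm_zero, Real.log_zero]
      have : 0 ≤ |z.im| - z.im := by linarith [le_abs_self z.im]
      positivity
    · rw [Real.log_le_iff_le_exp (norm_pos_iff.2 h0)]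
      exact hb z hz

theorem zeroCount_mul {F G : ℂ → ℂ} (hF : Differentiable ℂ F) (hG : Differentiable ℂ G) (r : ℝ) :
    zeroCount r (fun z => F z * G z) = zeroCount r F + zeroCount r G := by
  rw [zeroCount, zeroCount, zeroCount, ← ENNReal.tsum_add]
  refine tsum_congr fun z => ?_
  have hF' := hF.differentiableOn.analyticOnNhd isOpen_univ (z : ℂ) (mem_univ _)
  have hG' := hG.differentiableOn.analyticOnNhd isOpen_univ (z : ℂ) (mem_univ _)
  have : analyticOrderAt (fun z => F z * G z) (z : ℂ) =
    analyticOrderAt F (z : ℂ) + analyticOrderAt G (z : ℂ) := analyticOrderAt_mul hF' hG'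
  rw [this]
  simp

theorem zeroCount_const_mul {F : ℂ → ℂ} (hF : Differentiable ℂ F) {a : ℂ} (ha : a ≠ 0) (r : ℝ) :
    zeroCount r (fun z => a * F z) = zeroCount r F := by
  rw [zeroCount_mul (differentiable_const a) hF]
  have : zeroCount r (fun _ => a) = 0 := by
    rw [zeroCount, ENNReal.tsum_eq_zero]
    intro z
    rw [(analyticAt_const (x := (z : ℂ))).analyticOrderAt_eq_zero.2 ha]
    simp
  rw [this, zero_add]

theorem closedBall_zero_subset_closedBall_half {r r₁ : ℝ} (hr₁ : r₁ = r + 1 / 2) :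
    Metric.closedBall (0 : ℂ) r ⊆ Metric.closedBall (((1 / 2 : ℝ) : ℂ)) r₁ := by
  refine Metric.closedBall_subset_closedBall' ?_
  rw [dist_zero_left, Complex.norm_real, hr₁]
  norm_num

theorem norm_bounds_of_norm_sub_half {r r₁ : ℝ} (hr : 0 < r) (hr₁ : r₁ = r + 1 / 2) {z : ℂ}
    (hz : ‖z - ((1 / 2 : ℝ) : ℂ)‖ = 2 * r₁) :
    z ≠ 0 ∧ ‖z‖⁻¹ ≤ 6 / (1 + 4 * r₁) ∧ 2 * ‖z‖ ≤ 1 + 4 * r₁ := by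
  have h0 : ‖((1 / 2 : ℝ) : ℂ)‖ = 1 / 2 := by rw [Complex.norm_real]; norm_num
  have h1 := norm_sub_le z ((1 / 2 : ℝ) : ℂ)
  have h2 := norm_sub_norm_le z ((1 / 2 : ℝ) : ℂ)
  rw [hz, h0] at h1 h2
  have hpos : 0 < ‖z‖ := by linarith
  refine ⟨norm_pos_iff.1 hpos, ?_, by linarith⟩
  rw [inv_eq_one_div, div_le_div_iff₀ hpos (by linarith)]
  linarith

theorem potentialNorm_nonneg (q : ℝ → ℝ) : 0 ≤ potentialNorm q :=
  integral_nonneg fun _ => abs_nonneg _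

section Counting

variable {q : ℝ → ℝ} {γ : ℝ} (h : 0 ≤ γ) (hq : Integrable q volume)
  (hz : ∀ᵐ t, t ∉ Icc 0 γ → q t = 0) {r r₁ : ℝ} (hr : 0 < r) (hr₁ : r₁ = r + 1 / 2)
include h hq hz hr hr₁

theorem zeroCount_jostWronskian_le : zeroCount r (jostWronskian q) ≤
    ENNReal.ofReal (1 / Real.log 2 * (4 * r₁ * γ / Real.pi + Real.log (1 + 4 * r₁) +
      6 * potentialNorm q / (1 + 4 * r₁))) := by
  have hN := potentialNorm_nonneg q
  have hL : 0 ≤ Real.log (1 + 4 * r₁) := Real.log_nonneg (by linarith)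
  have h14 : 0 < 1 + 4 * r₁ := by linarith
  have hc : 1 ≤ ‖jostWronskian q ((1 / 2 : ℝ) : ℂ)‖ := by
    have := le_norm_jostWronskian h hq hz (1 / 2)
    linarith
  refine (zeroCount_le (differentiable_jostWronskian h hq hz le_rfl h) hc (ρ := r₁) (α := γ)
    (β := Real.log (1 + 4 * r₁) + 6 * potentialNorm q / (1 + 4 * r₁)) (by linarith)
    (closedBall_zero_subset_closedBall_half hr₁) h (by positivity) fun z hzs => ?_).trans
      (le_of_eq ?_)
  · obtain ⟨hz0, hinv, h2⟩ := norm_bounds_of_norm_sub_half hr hr₁ hzs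
    refine (norm_jostWronskian_le h hq hz hz0).trans ?_
    rw [← add_assoc, add_comm (γ * _), add_assoc, Real.exp_add, Real.exp_log h14, Real.exp_add]
    have h3 := mul_le_mul_of_nonneg_right hinv hN
    rw [div_mul_eq_mul_div] at h3
    gcongr
  · congr 2
    ring

theorem zeroCount_jostPlus_add_le :
    (zeroCount r (jostPlus q 0) + zeroCount r (jostPlusDeriv q 0)) / 2 ≤
    ENNReal.ofReal (1 / Real.log 2 * (4 * r₁ * γ / Real.pi + Real.log (1 + 4 * r₁) +
      6 * potentialNorm q / (1 + 4 * r₁))) := by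
  have hN := potentialNorm_nonneg q
  have hL : 0 ≤ Real.log (1 + 4 * r₁) := Real.log_nonneg (by linarith)
  have h14 : 0 < 1 + 4 * r₁ := by linarith
  have hlog2 : 0 < Real.log 2 := Real.log_pos one_lt_two
  have hu := differentiable_jostPlus_zero h hq hz le_rfl h
  have hv := differentiable_jostPlusDeriv_zero h hq hz le_rfl h
  rw [← zeroCount_mul hu hv, ← zeroCount_const_mul (hu.fun_mul hv) (two_ne_zero (α := ℂ))]
  have hc : 1 ≤ ‖2 * (jostPlus q 0 ((1 / 2 : ℝ) : ℂ) * jostPlusDeriv q 0 ((1 / 2 : ℝ) : ℂ))‖ := by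
    have := le_norm_jostPlus_mul h hq hz (1 / 2)
    rw [norm_mul, Complex.norm_ofNat]
    linarith
  have key := zeroCount_le ((hu.fun_mul hv).const_mul 2) hc (ρ := r₁) (α := 2 * γ)
    (β := Real.log (1 + 4 * r₁) + 2 * (6 * potentialNorm q / (1 + 4 * r₁))) (by linarith)
    (closedBall_zero_subset_closedBall_half hr₁) (by positivity) (by positivity) fun z hzs => ?_
  · rw [ENNReal.div_le_iff (two_ne_zero (α := ℝ≥0∞)) ENNReal.ofNat_ne_top]
    refine key.trans ?_
    have e2 : ∀ x : ℝ, ENNReal.ofReal x * 2 = ENNReal.ofReal (x * 2) := fun x => by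
      rw [ENNReal.ofReal_mul' (by norm_num : (0 : ℝ) ≤ 2), ENNReal.ofReal_ofNat]
    rw [e2]
    refine ENNReal.ofReal_le_ofReal ?_
    rw [mul_assoc (1 / Real.log 2)]
    refine mul_le_mul_of_nonneg_left ?_ (by positivity)
    have e : 2 * γ * (4 * r₁ / Real.pi) = 2 * (4 * r₁ * γ / Real.pi) := by ring
    linarith
  · obtain ⟨hz0, hinv, h2⟩ := norm_bounds_of_norm_sub_half hr hr₁ hzs
    have h3 := mul_le_mul_of_nonneg_right hinv hN
    rw [div_mul_eq_mul_div] at h3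
    set E := Real.exp (γ * (|z.im| - z.im)) * Real.exp (‖z‖⁻¹ * potentialNorm q) with hE
    have hEle : E ≤ Real.exp (γ * (|z.im| - z.im) + 6 * potentialNorm q / (1 + 4 * r₁)) := by
      rw [hE, ← Real.exp_add]
      exact Real.exp_le_exp.2 (by linarith)
    rw [norm_mul, norm_mul, Complex.norm_ofNat]
    calc 2 * (‖jostPlus q 0 z‖ * ‖jostPlusDeriv q 0 z‖)
        ≤ 2 * (E * (‖z‖ * E)) := by
          gcongr
          · exact norm_jostPlus_zero_le h hq hz hz0
          · exact norm_jostPlusDeriv_zero_le h hq hz hz0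
      _ = 2 * ‖z‖ * (E * E) := by ring
      _ ≤ (1 + 4 * r₁) *
          (Real.exp (γ * (|z.im| - z.im) + 6 * potentialNorm q / (1 + 4 * r₁)) *
            Real.exp (γ * (|z.im| - z.im) + 6 * potentialNorm q / (1 + 4 * r₁))) := by gcongr
      _ = _ := by
          conv_lhs => rw [← Real.exp_log h14]
          rw [← Real.exp_add, ← Real.exp_add]
          congr 1
          rw [Real.exp_log h14]
          ring

end Counting

theorem theorem1p1 (q : ℝ → ℝ) (hq : Integrable q volume) (hsupp : IsCompact (essSupport q)) :
    -- the Jost solutions, the Wronskian and the Jost functions are well defined, the last entire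
    ((∀ k : ℂ, ∃! f : ℝ → ℂ, IsJostPlus q k f) ∧
      (∀ k : ℂ, ∃! f : ℝ → ℂ, IsJostMinus q k f) ∧
      (∀ (x : ℝ) (k : ℂ), jostWronskianAt q x k = jostWronskian q k) ∧
      Differentiable ℂ (jostWronskian q) ∧
      Differentiable ℂ (jostPlus q 0) ∧
      Differentiable ℂ (jostPlusDeriv q 0)) ∧
    -- the operator on the line
    (∀ γ : ℝ, IsSupportInterval q 0 γ → ∀ r r₁ : ℝ, 0 < r → r₁ = r + 1 / 2 →
      zeroCount r (jostWronskian q) ≤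
        ENNReal.ofReal (1 / Real.log 2 * (4 * r₁ * γ / Real.pi + Real.log (1 + 4 * r₁) +
          9 * max (potentialNorm q) (potentialMoment q) / (1 + 4 * r₁)))) ∧
    -- the operators on the half-line; the potential is extended by zero to the line
    (essSupport q ⊆ Ici 0 → ∀ γ : ℝ, γ = sSup (essSupport q) →
      ∀ r r₁ : ℝ, 0 < r → r₁ = r + 1 / 2 →
      (zeroCount r (jostPlus q 0) + zeroCount r (jostPlusDeriv q 0)) / 2 ≤
        ENNReal.ofReal (1 / Real.log 2 * (4 * r₁ * γ / Real.pi + Real.log (1 + 4 * r₁) +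
          9 * (potentialNorm q * max 1 γ) / (1 + 4 * r₁)))) := by
  have hmono : ∀ (γ : ℝ) {r r₁ M : ℝ}, 0 < r → r₁ = r + 1 / 2 → potentialNorm q ≤ M →
      ENNReal.ofReal (1 / Real.log 2 * (4 * r₁ * γ / Real.pi + Real.log (1 + 4 * r₁) +
        6 * potentialNorm q / (1 + 4 * r₁))) ≤
      ENNReal.ofReal (1 / Real.log 2 * (4 * r₁ * γ / Real.pi + Real.log (1 + 4 * r₁) +
        9 * M / (1 + 4 * r₁))) := by
    intro γ r r₁ M hr hr₁ hM
    have hlog2 : 0 < Real.log 2 := Real.log_pos one_lt_two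
    have h14 : 0 < 1 + 4 * r₁ := by linarith
    have hN := potentialNorm_nonneg q
    refine ENNReal.ofReal_le_ofReal (mul_le_mul_of_nonneg_left ?_ (by positivity))
    have : 6 * potentialNorm q / (1 + 4 * r₁) ≤ 9 * M / (1 + 4 * r₁) := by
      gcongr ?_ / _
      linarith
    linarith
  refine ⟨?_, ?_, ?_⟩
  · obtain ⟨R, hR⟩ := hsupp.isBounded.subset_closedBall 0
    have hsub : essSupport q ⊆ Icc (-|R|) |R| := fun x hx => by
      have := hR hx
      rw [mem_closedBall_zero_iff, Real.norm_eq_abs] at this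
      exact abs_le.1 (this.trans (le_abs_self R))
    have h : -|R| ≤ |R| := neg_le_self (abs_nonneg R)
    have ha : -|R| ≤ 0 := neg_nonpos.2 (abs_nonneg R)
    have hz := ae_eq_zero_of_essSupport_subset hsub
    exact ⟨existsUnique_isJostPlus h hq hz, existsUnique_isJostMinus h hq hz,
      fun x k => jostWronskianAt_eq h hq hz k x,
      differentiable_jostWronskian h hq hz ha (abs_nonneg R),
      differentiable_jostPlus_zero h hq hz ha (abs_nonneg R),
      differentiable_jostPlusDeriv_zero h hq hz ha (abs_nonneg R)⟩
  · intro γ hγ r r₁ hr hr₁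
    exact (zeroCount_jostWronskian_le hγ.1 hq (ae_eq_zero_of_essSupport_subset hγ.2.1) hr
      hr₁).trans (hmono γ hr hr₁ (le_max_left _ _))
  · intro h0 γ hγ r r₁ hr hr₁
    have hsub : essSupport q ⊆ Icc 0 γ := fun x hx =>
      ⟨h0 hx, hγ ▸ le_csSup hsupp.bddAbove hx⟩
    have hγ0 : 0 ≤ γ := hγ ▸ Real.sSup_nonneg h0
    exact (zeroCount_jostPlus_add_le hγ0 hq (ae_eq_zero_of_essSupport_subset hsub) hr
      hr₁).trans (hmono γ hr hr₁
        (le_mul_of_one_le_right (potentialNorm_nonneg q) (le_max_left _ _)))
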